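/- Let $n_z,n_y\ge 1$, $n_w,n_q,n_s,n_p\ge 0$ and let $A\in\mathbb R^{n_z\times n_z}$, $B\in\mathbb R^{n_z\times n_s}$, $C\in\mathbb R^{n_y\times n_z}$, $N\in\mathbb R^{n_z\times n_w}$, $S\in\mathbb R^{n_q\times n_z}$, $C_p\in\mathbb R^{n_p\times n_z}$. Let $\psi:\mathbb R^{n_q}\to\mathbb R^{n_s}$ satisfy $|\psi(v_1)-\psi(v_2)|\le\ell|v_1-v_2|$ for all $v_1,v_2$, with $\ell>0$, and let $0<T_1\le T_2$. For gains $L\in\mathbb R^{n_z\times n_y}$, $H\in\mathbb R^{n_y\times n_y}$ let $\mathcal H_e$ be the hybrid system with state $x=(z,\varepsilon,\tilde\theta,\tau)\in\mathbb R^{2n_z+n_y+1}$, input $u=(w,\eta)\in\mathbb R^{n_w+n_y}$ and output $y_p=C_p\varepsilon$ which flows, when $\tau\in[0,T_2]$, according to $$\dot z=Az+B\psi(Sz)+Nw,\qquad \begin{pmatrix}\dot\varepsilon\\ \dot{\tilde\theta}\end{pmatrix}=\begin{pmatrix}A-LC&L\\ CA-CLC-HC&CL+H\end{pmatrix}\begin{pmatrix}\varepsilon\\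 \tilde\theta\end{pmatrix}+\begin{pmatrix}B\\ CB\end{pmatrix}\bigl(\psi(Sz)-\psi(S(z-\varepsilon))\bigr)+\begin{pmatrix}N\\ CN\end{pmatrix}w,\qquad \dot\tau=-1,$$ and jumps, when $\tau=0$, according to $z^+=z$, $\varepsilon^+=\varepsilon$, $\tilde\theta^+=-\eta$, $\tau^+\in[T_1,T_2]$. Solution pairs $(\phi,u)$ are taken in the usual sense on hybrid time domains: $\phi(\cdot,j)$ is locally absolutely continuous, and $u(\cdot,j)$ is measurable and essentially bounded on bounded time intervals. Let $\mathcal A=\mathbb R^{n_z}\times\{0\}\times\{0\}\times[0,T_2]$, let $|x|_{\mathcal A}$ be the Euclidean distance of $x$ to $\mathcal A$, and let $\|u\|_\infty$ be the $\mathcal L_\infty$ norm of a hybrid signal (the larger of the essential supremum of $|u|$ along flows and the supremum of $|u|$ at the jump points). For symmetric positive definite $P_1\in\mathbb R^{n_z\times n_z}$, $P_2\in\mathbb R^{n_y\times n_y}$, real numbers $\delta,\chi,\gamma>0$ and $\tau\in[0,T_2]$ let $\mathcal M_0(\tau)$ be the symmetric matrix (with $\operatorname{He}(X)=X+X^{\mathsf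 T}$ and $\bullet$ standing for the symmetric blocks) $$\mathcal M_0(\tau)=\begin{pmatrix} \operatorname{He}(P_1(A-LC))+C_p^{\mathsf T}C_p+\chi\ell^2S^{\mathsf T}S & P_1L+e^{\delta\tau}(CA-CLC-HC)^{\mathsf T}P_2 & P_1N & P_1B\\ \bullet & e^{\delta\tau}\bigl(\operatorname{He}(P_2(CL+H))-\delta P_2\bigr) & e^{\delta\tau}P_2CN & e^{\delta\tau}P_2CB\\ \bullet&\bullet&-\gamma^2 I_{n_w}&0\\ \bullet&\bullet&\bullet&-\chi I_{n_s}\end{pmatrix}.$$ Let $\gamma>0$ be given, and suppose that there are symmetric positive definite $P_1,P_2$, real numbers $\delta,\chi>0$ and matrices $L,H$ such that $\mathcal M_0(0)<0$ and $\mathcal M_0(T_2)<0$. Put $$\beta=-\max_{\tau\in[0,T_2]}\lambda_{\max}(\mathcal M_0(\tau)),\qquad \rho_2=\max\{\lambda_{\max}(P_1),\lambda_{\max}(P_2)e^{\delta T_2}\}.$$ Then the maximum is attained, $\beta>0$, and for the system $\mathcal H_e$ with these gains $L,H$: 1. $\mathcal H_e$ is exponentially input-to-state stable (eISS) with respect to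 $\mathcal A$: every maximal solution pair is complete, and there are $\kappa,\lambda>0$ and a class-$\mathcal K$ function $\rho$ such that every solution pair $(\phi,u)$ with $\|u\|_\infty<\infty$ satisfies $|\phi(t,j)|_{\mathcal A}\le\max\{\kappa e^{-\lambda(t+j)}|\phi(0,0)|_{\mathcal A},\rho(\|u\|_\infty)\}$ for all $(t,j)\in\operatorname{dom}\phi$. 2. The decay rate with respect to the flow time is $\beta/(2\rho_2)$: there are $\kappa>0$ and a class-$\mathcal K$ function $\rho$ such that every solution pair $(\phi,u)$ with $\|u\|_\infty<\infty$ satisfies $|\phi(t,j)|_{\mathcal A}\le\max\{\kappa e^{-\frac{\beta}{2\rho_2}t}|\phi(0,0)|_{\mathcal A},\rho(\|u\|_\infty)\}$ for all $(t,j)\in\operatorname{dom}\phi$. 3. There is $\alpha>0$ such that every solution pair $(\phi,u)$, $u=(w,\eta)$, with $\eta\equiv0$ satisfies $$\sqrt{\int_{\mathcal I}|y_p(s,j(s))|^2ds}\le\alpha|\phi(0,0)|_{\mathcal A}+\gamma\sqrt{\int_{\mathcal I}|w(s,j(s))|^2ds},$$ where $\mathcal I=\{t:\exists j,\ (t,j)\in\operatorname{dom}\phi\}$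 and $j(s)=\min\{j:(s,j)\in\operatorname{dom}\phi\}$; the integrals take values in $[0,\infty]$. -/

import Mathlib

open Set MeasureTheory Matrix
open scoped ENNReal

noncomputable section

/-! ### Hybrid time domains and hybrid signals -/

/-- `E ⊆ ℝ≥0 × ℕ` is a hybrid time domain: a union of a finite or infinite sequence of intervals
`[t_j, t_{j+1}] × {j}`, the last interval (if it exists) being allowed to be of the form
`[t_J, T)` with `T` finite or infinite. -/
def IsHybridTimeDomain (E : Set (ℝ × ℕ)) : Prop :=
  ∃ t : ℕ → ℝ, t 0 = 0 ∧ Monotone t ∧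
    ((E = {p | p.1 ∈ Icc (t p.2) (t (p.2 + 1))}) ∨
      ∃ (J : ℕ) (I : Set ℝ),
        ((∃ T, t J ≤ T ∧ I = Icc (t J) T) ∨ (∃ T, t J < T ∧ I = Ico (t J) T) ∨ I = Ici (t J)) ∧
        E = {p | (p.2 < J ∧ p.1 ∈ Icc (t p.2) (t (p.2 + 1))) ∨ (p.2 = J ∧ p.1 ∈ I)})

/-- The time slice `{t | (t, j) ∈ E}`. -/
def hybridSlice (E : Set (ℝ × ℕ)) (j : ℕ) : Set ℝ := {t | (t, j) ∈ E}

/-- `dom_t`: the projection of the domain on the ordinary-time axis. -/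
def domTime (E : Set (ℝ × ℕ)) : Set ℝ := {t | ∃ j, (t, j) ∈ E}

/-- `j(t) = min {j | (t, j) ∈ E}`. -/
def minJump (E : Set (ℝ × ℕ)) (t : ℝ) : ℕ := sInf {j | (t, j) ∈ E}

/-- `Γ`: the points `(t, j)` of the domain such that `(t, j + 1)` is in the domain. -/
def jumpTimes (E : Set (ℝ × ℕ)) : Set (ℝ × ℕ) := {p | p ∈ E ∧ (p.1, p.2 + 1) ∈ E}

/-- A signal `φ` over the hybrid time domain `E` is a hybrid arc: `φ(·, j)` is locally absolutely
continuous for each `j`. (Signals are total functions; only the values on `E` are ever used.) -/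
def IsHybridArc {X : Type*} [NormedAddCommGroup X] (E : Set (ℝ × ℕ)) (φ : ℝ → ℕ → X) : Prop :=
  ∀ (j : ℕ) (a b : ℝ), a ≤ b → Icc a b ⊆ hybridSlice E j →
    AbsolutelyContinuousOnInterval (fun t => φ t j) a b

/-- A signal `u` over the hybrid time domain `E` is a hybrid input: for each `j`, `u(·, j)` is
Lebesgue measurable and locally essentially bounded, i.e. essentially bounded on every bounded
part of its interval of definition. -/
def IsHybridInput {U : Type*} [NormedAddCommGroup U] (E : Set (ℝ × ℕ)) (u : ℝ → ℕ → U) : Prop :=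
  ∀ j : ℕ, AEStronglyMeasurable (fun t => u t j) (volume.restrict (hybridSlice E j)) ∧
    ∀ T : ℝ, ∃ K : ℝ, ∀ᵐ t ∂(volume.restrict (hybridSlice E j ∩ Iic T)), ‖u t j‖ ≤ K

/-- The `T`-truncated `L_∞` norm of a hybrid signal: the maximum of the essential supremum over
`E \ Γ` and of the supremum over `Γ`, both restricted to `t + j ≤ T`. -/
def truncLinfNorm {U : Type*} [NormedAddCommGroup U] (E : Set (ℝ × ℕ)) (u : ℝ → ℕ → U) (T : ℝ) :
    ℝ≥0∞ :=
  max
    (⨆ k : ℕ, essSup (fun s => ‖u s k‖ₑ)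
      (volume.restrict {s : ℝ | (s, k) ∈ E \ jumpTimes E ∧ s + k ≤ T}))
    (⨆ p ∈ {p : ℝ × ℕ | p ∈ jumpTimes E ∧ p.1 + p.2 ≤ T}, ‖u p.1 p.2‖ₑ)

/-- The `L_∞` norm of a hybrid signal. The truncated norm is nondecreasing in `T`, so that its
limit is its supremum. -/
def linfNorm {U : Type*} [NormedAddCommGroup U] (E : Set (ℝ × ℕ)) (u : ℝ → ℕ → U) : ℝ≥0∞ :=
  ⨆ T : ℝ, truncLinfNorm E u T

/-! ### Hybrid systems with inputs and outputs -/

/-- The data `(C, f, D, G, h)` of a hybrid system with state space `X`, input space `U` and output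
space `Y`. -/
structure HybridSystem (X U Y : Type*) where
  flowSet : Set X
  flowMap : X → U → X
  jumpSet : Set X
  jumpMap : X → U → Set X
  output : X → Y

/-- `(φ, u)`, with common domain `E`, is a solution pair to `H`. -/
structure IsSolutionPair {X U Y : Type*} [NormedAddCommGroup X] [NormedSpace ℝ X]
    [NormedAddCommGroup U] (H : HybridSystem X U Y)
    (E : Set (ℝ × ℕ)) (φ : ℝ → ℕ → X) (u : ℝ → ℕ → U) : Prop where
  domain : IsHybridTimeDomain E
  arc : IsHybridArc E φ
  input : IsHybridInput E u
  initial : φ 0 0 ∈ H.flowSet ∪ H.jumpSet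
  flow : ∀ j : ℕ, ∀ᵐ t : ℝ, (t, j) ∈ E →
    φ t j ∈ H.flowSet ∧
      HasDerivWithinAt (fun s => φ s j) (H.flowMap (φ t j) (u t j)) (hybridSlice E j) t
  jump : ∀ (t : ℝ) (j : ℕ), (t, j) ∈ E → (t, j + 1) ∈ E →
    φ t j ∈ H.jumpSet ∧ φ t (j + 1) ∈ H.jumpMap (φ t j) (u t j)

/-- A solution pair is maximal if it cannot be extended. -/
def IsMaximalSolutionPair {X U Y : Type*} [NormedAddCommGroup X] [NormedSpace ℝ X]
    [NormedAddCommGroup U] (H : HybridSystem X U Y)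
    (E : Set (ℝ × ℕ)) (φ : ℝ → ℕ → X) (u : ℝ → ℕ → U) : Prop :=
  IsSolutionPair H E φ u ∧
    ∀ (E' : Set (ℝ × ℕ)) (φ' : ℝ → ℕ → X) (u' : ℝ → ℕ → U),
      IsSolutionPair H E' φ' u' → E ⊆ E' →
      (∀ p ∈ E, φ' p.1 p.2 = φ p.1 p.2 ∧ u' p.1 p.2 = u p.1 p.2) → E' = E

/-- Class `K` functions on `[0, ∞)`. -/
def IsClassK (ρ : ℝ → ℝ) : Prop :=
  ContinuousOn ρ (Ici 0) ∧ StrictMonoOn ρ (Ici 0) ∧ ρ 0 = 0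

/-- Pre-exponential input-to-state stability with respect to `𝒜`. -/
def IsPreEISS {X U Y : Type*} [NormedAddCommGroup X] [NormedSpace ℝ X]
    [NormedAddCommGroup U] (H : HybridSystem X U Y) (𝒜 : Set X) : Prop :=
  ∃ (κ lam : ℝ) (ρ : ℝ → ℝ), 0 < κ ∧ 0 < lam ∧ IsClassK ρ ∧
    ∀ (E : Set (ℝ × ℕ)) (φ : ℝ → ℕ → X) (u : ℝ → ℕ → U),
      IsSolutionPair H E φ u → linfNorm E u < ∞ →
      ∀ (t : ℝ) (j : ℕ), (t, j) ∈ E →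
        Metric.infDist (φ t j) 𝒜 ≤
          max (κ * Real.exp (-lam * (t + j)) * Metric.infDist (φ 0 0) 𝒜)
            (ρ (linfNorm E u).toReal)

/-- Exponential input-to-state stability with respect to `𝒜`: pre-exponential input-to-state
stability, and every maximal solution pair is complete (has an unbounded domain). -/
def IsEISS {X U Y : Type*} [NormedAddCommGroup X] [NormedSpace ℝ X]
    [NormedAddCommGroup U] (H : HybridSystem X U Y) (𝒜 : Set X) : Prop :=
  IsPreEISS H 𝒜 ∧
    ∀ (E : Set (ℝ × ℕ)) (φ : ℝ → ℕ → X) (u : ℝ → ℕ → U),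
      IsMaximalSolutionPair H E φ u → ¬ Bornology.IsBounded E

/-- The input-to-state estimate holds with exponential decay rate `r` with respect to the flow
time `t`. -/
def HasFlowTimeDecayRate {X U Y : Type*} [NormedAddCommGroup X] [NormedSpace ℝ X]
    [NormedAddCommGroup U] (H : HybridSystem X U Y) (𝒜 : Set X) (r : ℝ) : Prop :=
  ∃ (κ : ℝ) (ρ : ℝ → ℝ), 0 < κ ∧ IsClassK ρ ∧
    ∀ (E : Set (ℝ × ℕ)) (φ : ℝ → ℕ → X) (u : ℝ → ℕ → U),
      IsSolutionPair H E φ u → linfNorm E u < ∞ →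
      ∀ (t : ℝ) (j : ℕ), (t, j) ∈ E →
        Metric.infDist (φ t j) 𝒜 ≤
          max (κ * Real.exp (-r * t) * Metric.infDist (φ 0 0) 𝒜)
            (ρ (linfNorm E u).toReal)

/-! ### The plant, the observer and the hybrid error system -/

/-- The data of the plant `ż = A z + B ψ(S z) + N w`, `y = C z + η`, of the performance output
`y_p = C_p (z - ẑ)`, of the Lipschitz constant `ℓ` of `ψ` and of the bounds `T₁ ≤ T₂` on the time
between measurements. -/
structure SampledPlant (nz ny nw nq ns np : ℕ) where
  A : Matrix (Fin nz) (Fin nz) ℝ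
  B : Matrix (Fin nz) (Fin ns) ℝ
  C : Matrix (Fin ny) (Fin nz) ℝ
  N : Matrix (Fin nz) (Fin nw) ℝ
  S : Matrix (Fin nq) (Fin nz) ℝ
  Cp : Matrix (Fin np) (Fin nz) ℝ
  ψ : EuclideanSpace ℝ (Fin nq) → EuclideanSpace ℝ (Fin ns)
  ell : ℝ
  T₁ : ℝ
  T₂ : ℝ

/-- The state space `ℝ^{2 n_z + n_y + 1}` of the error system, with its Euclidean norm; its points
are `x = (z, (ε, θ̃), τ)`. -/
abbrev ErrState (nz ny : ℕ) : Type :=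
  EuclideanSpace ℝ (Fin nz ⊕ ((Fin nz ⊕ Fin ny) ⊕ Unit))

/-- The input space `ℝ^{n_w + n_y}`, with its Euclidean norm; its points are `u = (w, η)`. -/
abbrev ErrInput (nw ny : ℕ) : Type := EuclideanSpace ℝ (Fin nw ⊕ Fin ny)

namespace ErrState

variable {nz ny : ℕ}

/-- Assemble a state from its components. -/
def mk (z : Fin nz → ℝ) (e : Fin nz ⊕ Fin ny → ℝ) (τ : ℝ) : ErrState nz ny :=
  WithLp.toLp 2 (Sum.elim z (Sum.elim e fun _ => τ))

def z (x : ErrState nz ny) : Fin nz → ℝ := fun i => x (Sum.inl i)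

/-- The pair `(ε, θ̃)`. -/
def err (x : ErrState nz ny) : Fin nz ⊕ Fin ny → ℝ := fun i => x (Sum.inr (Sum.inl i))

def ε (x : ErrState nz ny) : Fin nz → ℝ := fun i => x.err (Sum.inl i)

def θ (x : ErrState nz ny) : Fin ny → ℝ := fun i => x.err (Sum.inr i)

def τ (x : ErrState nz ny) : ℝ := x (Sum.inr (Sum.inr ()))

end ErrState

namespace ErrInput

variable {nw ny : ℕ}

def w (u : ErrInput nw ny) : Fin nw → ℝ := fun i => u (Sum.inl i)

def η (u : ErrInput nw ny) : Fin ny → ℝ := fun i => u (Sum.inr i)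

end ErrInput

namespace SampledPlant

variable {nz ny nw nq ns np : ℕ}

/-- `ψ` on coordinate vectors. -/
def psi (p : SampledPlant nz ny nw nq ns np) (v : Fin nq → ℝ) : Fin ns → ℝ :=
  WithLp.ofLp (p.ψ (WithLp.toLp 2 v))

/-- `ζ(v₁, v₂) = ψ(S v₁) - ψ(S (v₁ - v₂))`. -/
def zeta (p : SampledPlant nz ny nw nq ns np) (v₁ v₂ : Fin nz → ℝ) : Fin ns → ℝ :=
  p.psi (p.S *ᵥ v₁) - p.psi (p.S *ᵥ (v₁ - v₂))

def matF (p : SampledPlant nz ny nw nq ns np)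
    (L : Matrix (Fin nz) (Fin ny) ℝ) (H : Matrix (Fin ny) (Fin ny) ℝ) :
    Matrix (Fin nz ⊕ Fin ny) (Fin nz ⊕ Fin ny) ℝ :=
  fromBlocks (p.A - L * p.C) L (p.C * p.A - p.C * L * p.C - H * p.C) (p.C * L + H)

def matT (p : SampledPlant nz ny nw nq ns np) : Matrix (Fin nz ⊕ Fin ny) (Fin nw) ℝ :=
  fromRows p.N (p.C * p.N)

def matQ (p : SampledPlant nz ny nw nq ns np) : Matrix (Fin nz ⊕ Fin ny) (Fin ns) ℝ :=
  fromRows p.B (p.C * p.B)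

/-- The hybrid system `H_e` with gains `L`, `H`. -/
def errorSystem (p : SampledPlant nz ny nw nq ns np)
    (L : Matrix (Fin nz) (Fin ny) ℝ) (H : Matrix (Fin ny) (Fin ny) ℝ) :
    HybridSystem (ErrState nz ny) (ErrInput nw ny) (EuclideanSpace ℝ (Fin np)) where
  flowSet := {x | x.τ ∈ Icc 0 p.T₂}
  flowMap x u := ErrState.mk
    (p.A *ᵥ x.z + p.B *ᵥ p.psi (p.S *ᵥ x.z) + p.N *ᵥ u.w)
    (p.matF L H *ᵥ x.err + p.matQ *ᵥ p.zeta x.z x.ε + p.matT *ᵥ u.w)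
    (-1)
  jumpSet := {x | x.τ = 0}
  jumpMap x u := {g | ∃ v ∈ Icc p.T₁ p.T₂, g = ErrState.mk x.z
    ((fromBlocks 1 0 0 0 : Matrix (Fin nz ⊕ Fin ny) (Fin nz ⊕ Fin ny) ℝ) *ᵥ x.err +
      (fromRows 0 (-1) : Matrix (Fin nz ⊕ Fin ny) (Fin ny) ℝ) *ᵥ u.η) v}
  output x := WithLp.toLp 2 (p.Cp *ᵥ x.ε)

/-- The set `𝒜 = ℝ^{n_z} × {0} × {0} × [0, T₂]`. -/
def attractor (p : SampledPlant nz ny nw nq ns np) : Set (ErrState nz ny) :=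
  {x | x.ε = 0 ∧ x.θ = 0 ∧ x.τ ∈ Icc 0 p.T₂}

/-- `L₂` external stability from `w` to `y_p` with gain `γ` when `η ≡ 0`. The integrals take
values in `[0, ∞]`. -/
def HasL2Gain (p : SampledPlant nz ny nw nq ns np)
    (L : Matrix (Fin nz) (Fin ny) ℝ) (H : Matrix (Fin ny) (Fin ny) ℝ) (γ : ℝ) : Prop :=
  ∃ α : ℝ, 0 < α ∧
    ∀ (E : Set (ℝ × ℕ)) (φ : ℝ → ℕ → ErrState nz ny) (u : ℝ → ℕ → ErrInput nw ny),
      IsSolutionPair (p.errorSystem L H) E φ u → (∀ q ∈ E, (u q.1 q.2).η = 0) →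
      (∫⁻ s in domTime E, ‖(p.errorSystem L H).output (φ s (minJump E s))‖ₑ ^ 2) ^ (1 / 2 : ℝ) ≤
        ENNReal.ofReal (α * Metric.infDist (φ 0 0) p.attractor) +
        ENNReal.ofReal γ *
          (∫⁻ s in domTime E,
            ‖(WithLp.toLp 2 (u s (minJump E s)).w : EuclideanSpace ℝ (Fin nw))‖ₑ ^ 2) ^ (1 / 2 : ℝ)

end SampledPlant

/-! ### The matrix inequality -/

/-- `He(X) = X + Xᵀ`. -/
def matHe {n : Type*} (X : Matrix n n ℝ) : Matrix n n ℝ := X + Xᵀ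

/-- The largest (real) eigenvalue of a symmetric matrix. -/
def lambdaMax {n : Type*} [Fintype n] [DecidableEq n] (X : Matrix n n ℝ) : ℝ :=
  sSup (spectrum ℝ X)

/-- The symmetric matrix `ℳ(τ)`, partitioned along `(ε, θ̃, w, ζ)`. -/
def SampledPlant.matM {nz ny nw nq ns np : ℕ} (p : SampledPlant nz ny nw nq ns np)
    (L : Matrix (Fin nz) (Fin ny) ℝ) (H : Matrix (Fin ny) (Fin ny) ℝ)
    (P₁ : Matrix (Fin nz) (Fin nz) ℝ) (P₂ : Matrix (Fin ny) (Fin ny) ℝ)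
    (δ χ γ lamt τ : ℝ) :
    Matrix ((Fin nz ⊕ Fin ny) ⊕ (Fin nw ⊕ Fin ns)) ((Fin nz ⊕ Fin ny) ⊕ (Fin nw ⊕ Fin ns)) ℝ :=
  let e : ℝ := Real.exp (δ * τ)
  let M₁₁ : Matrix (Fin nz) (Fin nz) ℝ :=
    matHe (P₁ * (p.A - L * p.C)) + (2 * lamt) • P₁ + p.Cpᵀ * p.Cp + (χ * p.ell ^ 2) • (p.Sᵀ * p.S)
  let M₁₂ : Matrix (Fin nz) (Fin ny) ℝ :=
    P₁ * L + e • ((p.C * p.A - p.C * L * p.C - H * p.C)ᵀ * P₂)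
  let M₂₂ : Matrix (Fin ny) (Fin ny) ℝ :=
    e • (matHe (P₂ * (p.C * L + H)) + (2 * lamt - δ) • P₂)
  let M₁' : Matrix (Fin nz ⊕ Fin ny) (Fin nw ⊕ Fin ns) ℝ :=
    fromBlocks (P₁ * p.N) (P₁ * p.B) (e • (P₂ * p.C * p.N)) (e • (P₂ * p.C * p.B))
  fromBlocks (fromBlocks M₁₁ M₁₂ M₁₂ᵀ M₂₂) M₁' M₁'ᵀ
    (fromBlocks (-(γ ^ 2) • 1) 0 0 (-χ • 1))

end

/-!
With `V(ε, θ̃, τ) = εᵀ P₁ ε + e^{δτ} θ̃ᵀ P₂ θ̃` as storage function, the quadratic form of `M₀(τ)`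
is `V' + |y_p|² - γ² |w|²` plus the term `χ (ℓ² |S ε|² - |Δψ|²)`, which is nonnegative because `ψ`
is `ℓ`-Lipschitz. Since `M₀(τ)` is affine in `e^{δτ} ∈ [1, e^{δT₂}]`, it is a convex combination of
`M₀(0)` and `M₀(T₂)`, hence negative definite with a margin `β` uniform in `τ`. Along flows this
gives `V' ≤ -β |(ε, θ̃)|² - |y_p|² + γ² |w|²`, and a jump adds at most `ρ₂ |η|²` to `V`.

Integrating the inequality yields the `L₂` gain. With `V ≤ ρ₂ |(ε, θ̃)|²` it yields decay of `V` at
rate `β / ρ₂`, that is, of the distance at rate `β / (2 ρ₂)`: consecutive jumps after the first are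
separated by at least `T₁`, so the discounted jump contributions are bounded by a geometric series,
and at most `(t + T₂) / T₁` jumps occur up to time `t`, so the decay in `t` is also a decay
in `t + j`.

Maximal solutions are complete because the flow map is Lipschitz, which excludes finite escape, and
because a solution on a domain that stops at a finite time is continued by a flow while `τ > 0` and
by a jump when `τ = 0`.
-/

open scoped NNReal

section QuadraticForm

variable {n : Type*} [Fintype n]

theorem dotProduct_self_nonneg (v : n → ℝ) : 0 ≤ v ⬝ᵥ v := by
  simpa only [star_trivial] using dotProduct_star_self_nonneg v

theorem euclideanNorm_sq_eq_dotProduct (x : EuclideanSpace ℝ n) : ‖x‖ ^ 2 = x.ofLp ⬝ᵥ x.ofLp := by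
  rw [EuclideanSpace.real_norm_sq_eq]
  simp only [dotProduct, pow_two]

end QuadraticForm

section LambdaMax

variable {n : Type*} [Fintype n] [DecidableEq n] {X : Matrix n n ℝ}

theorem dotProduct_mulVec_le_lambdaMax (hX : X.IsHermitian) (v : n → ℝ) :
    v ⬝ᵥ X *ᵥ v ≤ lambdaMax X * (v ⬝ᵥ v) := by
  have hbdd : BddAbove (spectrum ℝ X) :=
    hX.spectrum_real_eq_range_eigenvalues ▸ (finite_range _).bddAbove
  have hpos : (algebraMap ℝ (Matrix n n ℝ) (lambdaMax X) - X).PosSemidef := by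
    refine posSemidef_iff_isHermitian_and_spectrum_nonneg.2
      ⟨.sub (by simp [Algebra.algebraMap_eq_smul_one, IsHermitian]) hX, ?_⟩
    rw [← spectrum.singleton_sub_eq]
    rintro _ ⟨_, rfl, y, hy, rfl⟩
    exact sub_nonneg.2 (le_csSup hbdd hy)
  have hform := hpos.dotProduct_mulVec_nonneg v
  rw [star_trivial, sub_mulVec, Algebra.algebraMap_eq_smul_one, smul_mulVec, one_mulVec,
    dotProduct_sub, dotProduct_smul, smul_eq_mul] at hform
  linarith

theorem exists_norm_eq_one_and_dotProduct_mulVec_eq_lambdaMax [Nonempty n] (hX : X.IsHermitian) :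
    ∃ x : EuclideanSpace ℝ n, ‖x‖ = 1 ∧ x.ofLp ⬝ᵥ X *ᵥ x.ofLp = lambdaMax X := by
  obtain ⟨i, hi⟩ : lambdaMax X ∈ range hX.eigenvalues := by
    rw [lambdaMax, hX.spectrum_real_eq_range_eigenvalues]
    exact (range_nonempty _).csSup_mem (finite_range _)
  have hnorm : ‖hX.eigenvectorBasis i‖ = 1 := hX.eigenvectorBasis.norm_eq_one i
  refine ⟨hX.eigenvectorBasis i, hnorm, ?_⟩
  rw [hX.mulVec_eigenvectorBasis, dotProduct_smul, ← euclideanNorm_sq_eq_dotProduct, hnorm, hi,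
    one_pow, smul_eq_mul, mul_one]

theorem lambdaMax_pos_of_posDef [Nonempty n] (hX : X.PosDef) : 0 < lambdaMax X := by
  obtain ⟨x, hx, hform⟩ := exists_norm_eq_one_and_dotProduct_mulVec_eq_lambdaMax hX.isHermitian
  have hx0 : x.ofLp ≠ 0 := (WithLp.ofLp_eq_zero 2).not.2 (norm_ne_zero_iff.1 (hx ▸ one_ne_zero))
  simpa only [star_trivial, hform] using hX.dotProduct_mulVec_pos hx0

theorem lambdaMax_neg_of_posDef_neg [Nonempty n] (hX : (-X).PosDef) : lambdaMax X < 0 := by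
  have hherm : X.IsHermitian := by simpa only [neg_neg] using hX.isHermitian.neg
  obtain ⟨x, hx, hform⟩ := exists_norm_eq_one_and_dotProduct_mulVec_eq_lambdaMax hherm
  have hx0 : x.ofLp ≠ 0 := (WithLp.ofLp_eq_zero 2).not.2 (norm_ne_zero_iff.1 (hx ▸ one_ne_zero))
  have hpos := hX.dotProduct_mulVec_pos hx0
  rwa [star_trivial, neg_mulVec, dotProduct_neg, hform, neg_pos] at hpos

omit [DecidableEq n] in
theorem exists_pos_forall_mul_dotProduct_self_le (hX : X.PosDef) :
    ∃ c : ℝ, 0 < c ∧ ∀ v : n → ℝ, c * (v ⬝ᵥ v) ≤ v ⬝ᵥ X *ᵥ v := by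
  classical
  cases isEmpty_or_nonempty n
  · exact ⟨1, one_pos, fun v => by simp [dotProduct]⟩
  · refine ⟨-lambdaMax (-X), neg_pos.2 (lambdaMax_neg_of_posDef_neg (by rwa [neg_neg])),
      fun v => ?_⟩
    have hle := dotProduct_mulVec_le_lambdaMax hX.isHermitian.neg v
    rw [neg_mulVec, dotProduct_neg] at hle
    linarith

theorem exists_isGreatest_lambdaMax [Nonempty n] {K : Type*} [TopologicalSpace K] {s : Set K}
    (hs : IsCompact s) (hne : s.Nonempty) {M : K → Matrix n n ℝ} (hM : ContinuousOn M s)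
    (hherm : ∀ k ∈ s, (M k).IsHermitian) :
    ∃ k ∈ s, IsGreatest ((fun k => lambdaMax (M k)) '' s) (lambdaMax (M k)) := by
  have hcont : ContinuousOn (fun q : K × EuclideanSpace ℝ n => q.2.ofLp ⬝ᵥ M q.1 *ᵥ q.2.ofLp)
      (s ×ˢ Metric.sphere 0 1) := by
    have hform : Continuous fun q : Matrix n n ℝ × (n → ℝ) => q.2 ⬝ᵥ q.1 *ᵥ q.2 :=
      continuous_snd.dotProduct (continuous_fst.matrix_mulVec continuous_snd)
    exact hform.comp_continuousOn ((hM.comp continuousOn_fst fun _ hq => hq.1).prodMk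
      ((PiLp.continuous_ofLp 2 _).comp continuous_snd).continuousOn)
  have hattained : ∀ k ∈ s, ∃ x : EuclideanSpace ℝ n,
      x ∈ Metric.sphere 0 1 ∧ x.ofLp ⬝ᵥ M k *ᵥ x.ofLp = lambdaMax (M k) := fun k hk => by
    simpa only [mem_sphere_zero_iff_norm] using
      exists_norm_eq_one_and_dotProduct_mulVec_eq_lambdaMax (hherm k hk)
  obtain ⟨k₀, hk₀⟩ := hne
  obtain ⟨x₀, hx₀, -⟩ := hattained k₀ hk₀
  obtain ⟨⟨k, y⟩, ⟨hk, hy⟩, hmax⟩ :=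
    (hs.prod (isCompact_sphere _ _)).exists_isMaxOn ⟨(k₀, x₀), hk₀, hx₀⟩ hcont
  refine ⟨k, hk, mem_image_of_mem _ hk, forall_mem_image.2 fun l hl => ?_⟩
  obtain ⟨x, hx, hform⟩ := hattained l hl
  calc lambdaMax (M l) = x.ofLp ⬝ᵥ M l *ᵥ x.ofLp := hform.symm
    _ ≤ y.ofLp ⬝ᵥ M k *ᵥ y.ofLp := isMaxOn_iff.1 hmax (l, x) ⟨hl, hx⟩
    _ ≤ lambdaMax (M k) * (y.ofLp ⬝ᵥ y.ofLp) := dotProduct_mulVec_le_lambdaMax (hherm k hk) _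
    _ = lambdaMax (M k) := by
      rw [← euclideanNorm_sq_eq_dotProduct, mem_sphere_zero_iff_norm.1 hy, one_pow, mul_one]

end LambdaMax

section AbsolutelyContinuous

theorem absolutelyContinuousOnInterval_const {X : Type*} [PseudoMetricSpace X] (x : X) (a b : ℝ) :
    AbsolutelyContinuousOnInterval (fun _ => x) a b :=
  (LipschitzWith.const x).lipschitzOnWith.absolutelyContinuousOnInterval

theorem absolutelyContinuousOnInterval_congr {X : Type*} [PseudoMetricSpace X] {f g : ℝ → X}
    {a b : ℝ} (hf : AbsolutelyContinuousOnInterval f a b) (hfg : EqOn f g (uIcc a b)) :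
    AbsolutelyContinuousOnInterval g a b := by
  rw [absolutelyContinuousOnInterval_iff] at hf ⊢
  intro r hr
  obtain ⟨δ, hδ, hfδ⟩ := hf r hr
  refine ⟨δ, hδ, fun E hE hEδ => ?_⟩
  convert hfδ E hE hEδ using 1
  refine Finset.sum_congr rfl fun i hi => ?_
  rw [hfg (hE.1 i hi).1, hfg (hE.1 i hi).2]

theorem absolutelyContinuousOnInterval_comp_lipschitzOnWith {X Y : Type*} [PseudoMetricSpace X]
    [PseudoMetricSpace Y] {f : ℝ → X} {g : X → Y} {K : ℝ≥0} {s : Set X} {a b : ℝ}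
    (hg : LipschitzOnWith K g s) (hf : AbsolutelyContinuousOnInterval f a b)
    (hfs : MapsTo f (uIcc a b) s) : AbsolutelyContinuousOnInterval (fun t => g (f t)) a b := by
  rw [absolutelyContinuousOnInterval_iff] at hf ⊢
  intro r hr
  obtain ⟨δ, hδ, hfδ⟩ := hf (r / (K + 1)) (by positivity)
  refine ⟨δ, hδ, fun E hE hEδ => ?_⟩
  refine lt_of_le_of_lt ?_ ((lt_div_iff₀ (by positivity)).1 (hfδ E hE hEδ))
  rw [Finset.sum_mul]
  refine Finset.sum_le_sum fun i hi =>
    (hg.dist_le_mul _ (hfs (hE.1 i hi).1) _ (hfs (hE.1 i hi).2)).trans ?_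
  rw [mul_comm]
  gcongr
  exact le_add_of_nonneg_right zero_le_one

theorem absolutelyContinuousOnInterval_comp_contDiff {E F : Type*} [NormedAddCommGroup E]
    [NormedSpace ℝ E] [NormedAddCommGroup F] [NormedSpace ℝ F] {f : ℝ → E} {g : E → F} {a b : ℝ}
    (hg : ContDiff ℝ 1 g) (hf : AbsolutelyContinuousOnInterval f a b) :
    AbsolutelyContinuousOnInterval (fun t => g (f t)) a b := by
  obtain ⟨K, hK⟩ := hg.locallyLipschitz.locallyLipschitzOn.exists_lipschitzOnWith_of_compact
    (isCompact_uIcc.image_of_continuousOn hf.continuousOn)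
  exact absolutelyContinuousOnInterval_comp_lipschitzOnWith hK hf (mapsTo_image f _)

theorem absolutelyContinuousOnInterval_comp_monotone {X : Type*} [PseudoMetricSpace X]
    {f : ℝ → X} {g : ℝ → ℝ} {K : ℝ≥0} {a b c d : ℝ} (hf : AbsolutelyContinuousOnInterval f c d)
    (hmono : Monotone g) (hlip : LipschitzWith K g) (hg : MapsTo g (uIcc a b) (uIcc c d)) :
    AbsolutelyContinuousOnInterval (fun t => f (g t)) a b := by
  rw [absolutelyContinuousOnInterval_iff] at hf ⊢
  intro r hr
  obtain ⟨δ, hδ, hfδ⟩ := hf r hr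
  refine ⟨δ / (K + 1), by positivity, fun E hE hEδ => ?_⟩
  refine hfδ (E.1, fun i => (g (E.2 i).1, g (E.2 i).2))
    ⟨fun i hi => ⟨hg (hE.1 i hi).1, hg (hE.1 i hi).2⟩, ?_⟩ ?_
  · refine hE.2.imp fun i j hij => Set.disjoint_left.2 fun z hzi hzj => ?_
    simp only [Function.onFun, uIoc, ← hmono.map_min, ← hmono.map_max, mem_Ioc] at hij hzi hzj
    have hlt : max (min (E.2 i).1 (E.2 i).2) (min (E.2 j).1 (E.2 j).2) <
        min (max (E.2 i).1 (E.2 i).2) (max (E.2 j).1 (E.2 j).2) :=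
      hmono.reflect_lt (by
        simpa only [hmono.map_max, hmono.map_min] using
          (max_lt hzi.1 hzj.1).trans_le (le_min hzi.2 hzj.2))
    exact Set.disjoint_left.1 hij ⟨(le_max_left _ _).trans_lt hlt, min_le_left _ _⟩
      ⟨(le_max_right _ _).trans_lt hlt, min_le_right _ _⟩
  · refine lt_of_le_of_lt ?_ ((lt_div_iff₀ (by positivity)).1 hEδ)
    rw [Finset.sum_mul]
    refine Finset.sum_le_sum fun i _ => (hlip.dist_le_mul _ _).trans ?_
    rw [mul_comm]
    gcongr
    exact le_add_of_nonneg_right zero_le_one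

theorem absolutelyContinuousOnInterval_piecewise {F : Type*} [NormedAddCommGroup F]
    {f g : ℝ → F} {a b c : ℝ} (hab : a ≤ b) (hbc : b ≤ c)
    (hf : AbsolutelyContinuousOnInterval f a b) (hg : AbsolutelyContinuousOnInterval g b c)
    (hfg : f b = g b) :
    AbsolutelyContinuousOnInterval (fun s => if s ≤ b then f s else g s) a c := by
  have hfmin : AbsolutelyContinuousOnInterval (fun s => f (min s b)) a c := by
    refine absolutelyContinuousOnInterval_comp_monotone hf (monotone_id.min monotone_const)
      (LipschitzWith.id.min_const b) fun s hs => ?_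
    rw [uIcc_of_le (hab.trans hbc)] at hs
    exact uIcc_of_le hab ▸ ⟨le_min hs.1 hab, min_le_right _ _⟩
  have hgmax : AbsolutelyContinuousOnInterval (fun s => g (max s b)) a c := by
    refine absolutelyContinuousOnInterval_comp_monotone hg (monotone_id.max monotone_const)
      (LipschitzWith.id.max_const b) fun s hs => ?_
    rw [uIcc_of_le (hab.trans hbc)] at hs
    exact uIcc_of_le hbc ▸ ⟨le_max_right _ _, max_le hs.2 hbc⟩
  refine absolutelyContinuousOnInterval_congr
    ((hfmin.fun_add hgmax).fun_sub (absolutelyContinuousOnInterval_const (g b) a c)) fun s _ => ?_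
  rcases le_or_gt s b with hs | hs
  · simp [hs]
  · simp [hs.le, hs.not_ge, hfg]

theorem sub_le_integral_of_ae_hasDerivAt_le {f g : ℝ → ℝ} {a b : ℝ} (hab : a ≤ b)
    (hf : AbsolutelyContinuousOnInterval f a b) (hg : IntervalIntegrable g volume a b)
    (hderiv : ∀ᵐ t, t ∈ Ioo a b → ∃ f' ≤ g t, HasDerivAt f f' t) :
    f b - f a ≤ ∫ t in a..b, g t := by
  rw [← hf.integral_deriv_eq_sub]
  refine intervalIntegral.integral_mono_ae_restrict hab hf.intervalIntegrable_deriv hg ?_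
  rw [Filter.EventuallyLE, restrict_Ioo_eq_restrict_Icc.symm, ae_restrict_iff' measurableSet_Ioo]
  filter_upwards [hderiv] with t ht hmem
  obtain ⟨f', hle, hd⟩ := ht hmem
  rwa [hd.deriv]

theorem lintegral_add_ofReal_le_of_ae_hasDerivAt_le {f g h : ℝ → ℝ} {a b : ℝ} (hab : a ≤ b)
    (hf : AbsolutelyContinuousOnInterval f a b) (hfa : 0 ≤ f a) (hfb : 0 ≤ f b)
    (hg : IntegrableOn g (Icc a b)) (hh : IntegrableOn h (Icc a b))
    (hg0 : ∀ t, 0 ≤ g t) (hh0 : ∀ t, 0 ≤ h t)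
    (hderiv : ∀ᵐ t, t ∈ Ioo a b → ∃ f' ≤ h t - g t, HasDerivAt f f' t) :
    (∫⁻ t in Icc a b, ENNReal.ofReal (g t)) + ENNReal.ofReal (f b) ≤
      ENNReal.ofReal (f a) + ∫⁻ t in Icc a b, ENNReal.ofReal (h t) := by
  have hgi := (intervalIntegrable_iff_integrableOn_Icc_of_le hab).2 hg
  have hhi := (intervalIntegrable_iff_integrableOn_Icc_of_le hab).2 hh
  have hreal := sub_le_integral_of_ae_hasDerivAt_le hab hf (hhi.sub hgi) hderiv
  rw [intervalIntegral.integral_sub hhi hgi, intervalIntegral.integral_of_le hab,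
    intervalIntegral.integral_of_le hab, ← integral_Icc_eq_integral_Ioc,
    ← integral_Icc_eq_integral_Ioc] at hreal
  rw [← ofReal_integral_eq_lintegral_ofReal hg (.of_forall hg0),
    ← ofReal_integral_eq_lintegral_ofReal hh (.of_forall hh0),
    ← ENNReal.ofReal_add (integral_nonneg hg0) hfb, ← ENNReal.ofReal_add hfa (integral_nonneg hh0)]
  exact ENNReal.ofReal_le_ofReal (by linarith)

theorem sub_le_exp_mul_of_ae_hasDerivAt_le {f : ℝ → ℝ} {a b c G : ℝ} (hab : a ≤ b)
    (hf : AbsolutelyContinuousOnInterval f a b)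
    (hderiv : ∀ᵐ t, t ∈ Ioo a b → ∃ f' ≤ -c * (f t - G), HasDerivAt f f' t) :
    f b - G ≤ Real.exp (-c * (b - a)) * (f a - G) := by
  have hexp : ContDiff ℝ 1 fun t : ℝ => Real.exp (c * t) := by fun_prop
  have hprod : AbsolutelyContinuousOnInterval (fun t => Real.exp (c * t) * (f t - G)) a b :=
    hexp.contDiffOn.absolutelyContinuousOnInterval.fun_mul
      (hf.fun_sub (absolutelyContinuousOnInterval_const G a b))
  have hanti := sub_le_integral_of_ae_hasDerivAt_le (g := fun _ => 0) hab hprod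
    intervalIntegrable_const (by
      filter_upwards [hderiv] with t ht hmem
      obtain ⟨f', hle, hd⟩ := ht hmem
      refine ⟨_, ?_, (((hasDerivAt_id t).const_mul c).exp).mul (hd.sub_const G)⟩
      simp only [id]
      nlinarith [mul_le_mul_of_nonneg_left hle (Real.exp_pos (c * t)).le])
  rw [intervalIntegral.integral_zero, sub_nonpos] at hanti
  have hratio : Real.exp (-c * (b - a)) = Real.exp (c * a) / Real.exp (c * b) := by
    rw [← Real.exp_sub]
    ring_nf
  rwa [hratio, div_mul_eq_mul_div, le_div_iff₀ (Real.exp_pos _), mul_comm]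

theorem norm_sub_le_mul_of_ae_hasDerivAt_norm_le {F : Type*} [NormedAddCommGroup F]
    [NormedSpace ℝ F] {f : ℝ → F} {a b M : ℝ} (hab : a ≤ b)
    (hf : AbsolutelyContinuousOnInterval f a b)
    (hderiv : ∀ᵐ t, t ∈ Ioo a b → ∃ f', ‖f'‖ ≤ M ∧ HasDerivAt f f' t) :
    ‖f b - f a‖ ≤ M * (b - a) := by
  obtain ⟨g, hg, hgf⟩ := exists_dual_vector'' ℝ (f b - f a)
  have hle := sub_le_integral_of_ae_hasDerivAt_le (f := fun t => g (f t)) (g := fun _ => M) hab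
    (absolutelyContinuousOnInterval_comp_contDiff g.contDiff hf) intervalIntegrable_const (by
      filter_upwards [hderiv] with t ht hmem
      obtain ⟨f', hf', hd⟩ := ht hmem
      exact ⟨g f', (le_abs_self _).trans ((g.le_of_opNorm_le hg f').trans (by rwa [one_mul])),
        g.hasFDerivAt.comp_hasDerivAt t hd⟩)
  rw [← map_sub, hgf, intervalIntegral.integral_const, smul_eq_mul, mul_comm] at hle
  exact hle

theorem eq_add_mul_of_ae_hasDerivAt_const {f : ℝ → ℝ} {a b c : ℝ} (hab : a ≤ b)
    (hf : AbsolutelyContinuousOnInterval f a b) (hderiv : ∀ᵐ t, t ∈ Ioo a b → HasDerivAt f c t) :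
    f b = f a + c * (b - a) := by
  have hlin : ContDiff ℝ 1 fun t : ℝ => c * t := by fun_prop
  have hconst := norm_sub_le_mul_of_ae_hasDerivAt_norm_le (M := 0) hab
    (hf.fun_sub hlin.contDiffOn.absolutelyContinuousOnInterval) (by
      filter_upwards [hderiv] with t ht hmem
      exact ⟨c - c * 1, by simp, (ht hmem).sub ((hasDerivAt_id t).const_mul c)⟩)
  rw [zero_mul, norm_le_zero_iff] at hconst
  linarith

end AbsolutelyContinuous

section DifferentialEquation

theorem exists_local_solution_of_lipschitzWith {X : Type*} [NormedAddCommGroup X]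
    [NormedSpace ℝ X] [CompleteSpace X] {F : X → X} {K : ℝ≥0} (hF : LipschitzWith K F)
    (x₀ : X) (T : ℝ) :
    ∃ h : ℝ, 0 < h ∧ ∃ f : ℝ → X, f T = x₀ ∧ AbsolutelyContinuousOnInterval f T (T + h) ∧
      ∀ s ∈ Ioo T (T + h), HasDerivAt f (F (f s)) s := by
  set M : ℝ≥0 := ‖F x₀‖₊ + K with hM
  set h : ℝ := 1 / (M + 1) with hh
  have hpos : 0 < h := by positivity
  have hmem : T ∈ Icc T (T + h) := left_mem_Icc.2 (by linarith)
  have hbound : ∀ x ∈ Metric.closedBall x₀ (1 : ℝ≥0), ‖F x‖ ≤ M := fun x hx => by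
    have hdist : dist (F x) (F x₀) ≤ K :=
      (hF.dist_le_mul x x₀).trans (mul_le_of_le_one_right K.2 (by simpa using hx))
    calc ‖F x‖ ≤ ‖F x₀‖ + dist (F x) (F x₀) := by
          rw [dist_eq_norm]
          exact norm_le_norm_add_norm_sub' _ _
      _ ≤ M := by
          rw [hM]
          push_cast
          linarith
  have hPL : IsPicardLindelof (fun _ => F) (⟨T, hmem⟩ : Icc T (T + h)) x₀ 1 0 M K := by
    refine .of_time_independent hbound hF.lipschitzOnWith ?_
    have : (M : ℝ) * h ≤ 1 := by
      rw [hh, mul_one_div, div_le_one (by positivity)]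
      linarith
    simpa [hpos.le] using this
  obtain ⟨f, hf₀, hf⟩ := hPL.exists_eq_forall_mem_Icc_hasDerivWithinAt₀
  have hcont : ContinuousOn f (Icc T (T + h)) := fun s hs => (hf s hs).continuousWithinAt
  obtain ⟨C, hC⟩ := isCompact_Icc.exists_bound_of_continuousOn
    (hF.continuous.comp_continuousOn hcont)
  have hlip : LipschitzOnWith C.toNNReal f (uIcc T (T + h)) := by
    rw [uIcc_of_le (by linarith)]
    refine (convex_Icc T (T + h)).lipschitzOnWith_of_nnnorm_hasDerivWithin_le hf fun s hs => ?_
    rw [← NNReal.coe_le_coe, coe_nnnorm]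
    exact (hC s hs).trans (Real.le_coe_toNNReal _)
  exact ⟨h, hpos, f, hf₀, hlip.absolutelyContinuousOnInterval, fun s hs =>
    (hf s (Ioo_subset_Icc_self hs)).hasDerivAt (Icc_mem_nhds hs.1 hs.2)⟩

variable {F : Type*} [NormedAddCommGroup F] {f : ℝ → F} {a T K C : ℝ}

theorem exists_forall_norm_le_of_linear_growth [InnerProductSpace ℝ F]
    (hac : ∀ b ∈ Ico a T, AbsolutelyContinuousOnInterval f a b)
    (hderiv : ∀ᵐ s, s ∈ Ioo a T → ∃ f', ‖f'‖ ≤ K * ‖f s‖ + C ∧ HasDerivAt f f' s) :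
    ∃ R : ℝ, ∀ b ∈ Ico a T, ‖f b‖ ≤ R := by
  set c := 2 * |K| + 1 with hc
  have hc0 : 0 < c := by positivity
  refine ⟨√(Real.exp (c * (T - a)) * (‖f a‖ ^ 2 + C ^ 2 / c)), fun b hb =>
    Real.le_sqrt_of_sq_le ?_⟩
  have hgronwall := sub_le_exp_mul_of_ae_hasDerivAt_le (c := -c) (G := -(C ^ 2 / c)) hb.1
    (absolutelyContinuousOnInterval_comp_contDiff (contDiff_norm_sq ℝ) (hac b hb)) (by
      filter_upwards [hderiv] with s hs hmem
      obtain ⟨f', hf', hd⟩ := hs ⟨hmem.1, hmem.2.trans hb.2⟩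
      refine ⟨_, ?_, hd.norm_sq⟩
      have hinner : inner ℝ (f s) f' ≤ ‖f s‖ * (|K| * ‖f s‖ + C) :=
        (real_inner_le_norm _ _).trans (by grw [hf', le_abs_self K])
      have hrhs : -(-c) * (‖f s‖ ^ 2 - -(C ^ 2 / c)) = c * ‖f s‖ ^ 2 + C ^ 2 := by
        field_simp
        ring
      rw [hrhs, hc]
      nlinarith [sq_nonneg (‖f s‖ - C)])
  rw [sub_neg_eq_add, sub_neg_eq_add, neg_neg] at hgronwall
  calc ‖f b‖ ^ 2 ≤ ‖f b‖ ^ 2 + C ^ 2 / c := le_add_of_nonneg_right (by positivity)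
    _ ≤ _ := hgronwall
    _ ≤ _ := by gcongr; exact hb.2.le

theorem exists_lipschitzWith_eqOn_of_linear_growth [InnerProductSpace ℝ F]
    [FiniteDimensional ℝ F] (hac : ∀ b ∈ Ico a T, AbsolutelyContinuousOnInterval f a b)
    (hderiv : ∀ᵐ s, s ∈ Ioo a T → ∃ f', ‖f'‖ ≤ K * ‖f s‖ + C ∧ HasDerivAt f f' s) :
    ∃ (M : ℝ≥0) (g : ℝ → F), LipschitzWith M g ∧ EqOn f g (Ico a T) := by
  obtain ⟨R, hR⟩ := exists_forall_norm_le_of_linear_growth hac hderiv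
  set M := |K| * R + C with hM
  have hle : ∀ x ∈ Ico a T, ∀ y ∈ Ico a T, x ≤ y → ‖f y - f x‖ ≤ M * (y - x) := by
    intro x hx y hy hxy
    refine norm_sub_le_mul_of_ae_hasDerivAt_norm_le hxy ((hac y hy).mono ?_) ?_
    · rw [uIcc_of_le hxy, uIcc_of_le hy.1]
      exact Icc_subset_Icc_left hx.1
    · filter_upwards [hderiv] with s hs hmem
      have hsI : s ∈ Ioo a T := ⟨hx.1.trans_lt hmem.1, hmem.2.trans hy.2⟩
      obtain ⟨f', hf', hd⟩ := hs hsI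
      refine ⟨f', hf'.trans ?_, hd⟩
      rw [hM]
      gcongr
      exacts [le_abs_self K, hR s (Ioo_subset_Ico_self hsI)]
  have hlip : LipschitzOnWith M.toNNReal f (Ico a T) := by
    refine LipschitzOnWith.of_dist_le_mul fun x hx y hy => ?_
    refine le_trans ?_ (mul_le_mul_of_nonneg_right (Real.le_coe_toNNReal M) dist_nonneg)
    rcases le_total x y with hxy | hyx
    · rw [dist_comm, dist_eq_norm, dist_comm, Real.dist_eq, abs_of_nonneg (sub_nonneg.2 hxy)]
      exact hle x hx y hy hxy
    · rw [dist_eq_norm, Real.dist_eq, abs_of_nonneg (sub_nonneg.2 hyx)]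
      exact hle y hy x hx hyx
  obtain ⟨g, hg, hfg⟩ := hlip.extend_finite_dimension
  exact ⟨_, g, hg, hfg⟩

end DifferentialEquation

section HybridTimeDomain

/-- The sets allowed as the last interval of a hybrid time domain, when it starts at `a`. -/
def IsLastInterval (a : ℝ) (I : Set ℝ) : Prop :=
  (∃ T, a ≤ T ∧ I = Icc a T) ∨ (∃ T, a < T ∧ I = Ico a T) ∨ I = Ici a

namespace IsLastInterval

variable {a : ℝ} {I : Set ℝ}

theorem left_mem (hI : IsLastInterval a I) : a ∈ I := by
  rcases hI with ⟨T, hT, rfl⟩ | ⟨T, hT, rfl⟩ | rfl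
  exacts [left_mem_Icc.2 hT, left_mem_Ico.2 hT, self_mem_Ici]

theorem subset_Ici (hI : IsLastInterval a I) : I ⊆ Ici a := by
  rcases hI with ⟨T, -, rfl⟩ | ⟨T, -, rfl⟩ | rfl
  exacts [Icc_subset_Ici_self, Ico_subset_Ici_self, subset_rfl]

theorem ordConnected (hI : IsLastInterval a I) : I.OrdConnected := by
  rcases hI with ⟨T, -, rfl⟩ | ⟨T, -, rfl⟩ | rfl
  exacts [ordConnected_Icc, ordConnected_Ico, ordConnected_Ici]

theorem exists_monotone_cofinal (hI : IsLastInterval a I) :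
    ∃ s : ℕ → ℝ, Monotone s ∧ (∀ n, s n ∈ I) ∧ ∀ x ∈ I, ∃ n, x ≤ s n := by
  rcases hI with ⟨T, hT, rfl⟩ | ⟨T, hT, rfl⟩ | rfl
  · exact ⟨fun _ => T, monotone_const, fun _ => right_mem_Icc.2 hT, fun x hx => ⟨0, hx.2⟩⟩
  · obtain ⟨s, hs, hsI, hlim⟩ := exists_seq_strictMono_tendsto' hT
    refine ⟨s, hs.monotone, fun n => ⟨(hsI n).1.le, (hsI n).2⟩, fun x hx => ?_⟩
    obtain ⟨n, hn⟩ := (hlim.eventually (lt_mem_nhds hx.2)).exists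
    exact ⟨n, hn.le⟩
  · refine ⟨fun n => a + n, fun m n hmn => by simpa using hmn, fun n => by simp, fun x _ => ?_⟩
    obtain ⟨n, hn⟩ := exists_nat_ge (x - a)
    exact ⟨n, by linarith⟩

theorem setLIntegral_le (hI : IsLastInterval a I) {f : ℝ → ℝ≥0∞} {K : ℝ≥0∞}
    (hf : ∀ s ∈ I, ∫⁻ x in Icc a s, f x ≤ K) : ∫⁻ x in I, f x ≤ K := by
  obtain ⟨s, hmono, hs, hcof⟩ := hI.exists_monotone_cofinal
  have hsub : I ⊆ ⋃ n, Icc a (s n) := fun x hx =>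
    mem_iUnion.2 ((hcof x hx).imp fun _ hn => ⟨hI.subset_Ici hx, hn⟩)
  refine (lintegral_mono_set hsub).trans ?_
  rw [setLIntegral_iUnion_of_directed _
    (Monotone.directed_le fun m n hmn => Icc_subset_Icc_right (hmono hmn))]
  exact iSup_le fun n => hf _ (hs n)

end IsLastInterval

/-- The hybrid time domain with `J` jumps, at the times `t 1, …, t J`, and last interval `I`. -/
def hybridDomainUpTo (t : ℕ → ℝ) (J : ℕ) (I : Set ℝ) : Set (ℝ × ℕ) :=
  {p | (p.2 < J ∧ p.1 ∈ Icc (t p.2) (t (p.2 + 1))) ∨ (p.2 = J ∧ p.1 ∈ I)}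

section hybridDomainUpTo

variable {t : ℕ → ℝ} {j J : ℕ} {I : Set ℝ}

theorem hybridSlice_hybridDomainUpTo_of_lt (hj : j < J) :
    hybridSlice (hybridDomainUpTo t J I) j = Icc (t j) (t (j + 1)) := by
  ext s
  simp [hybridSlice, hybridDomainUpTo, hj, hj.ne]

theorem hybridSlice_hybridDomainUpTo_self : hybridSlice (hybridDomainUpTo t J I) J = I := by
  ext s
  simp [hybridSlice, hybridDomainUpTo]

theorem hybridSlice_hybridDomainUpTo_of_gt (hj : J < j) :
    hybridSlice (hybridDomainUpTo t J I) j = ∅ := by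
  ext s
  simp [hybridSlice, hybridDomainUpTo, hj.not_gt, hj.ne']

theorem isHybridTimeDomain_hybridDomainUpTo (h0 : t 0 = 0) (hmono : Monotone t)
    (hI : IsLastInterval (t J) I) : IsHybridTimeDomain (hybridDomainUpTo t J I) :=
  ⟨t, h0, hmono, Or.inr ⟨J, I, hI, rfl⟩⟩

end hybridDomainUpTo

theorem IsHybridTimeDomain.zero_mem {E : Set (ℝ × ℕ)} (hE : IsHybridTimeDomain E) :
    (0, 0) ∈ E := by
  obtain ⟨t, h0, hmono, rfl | ⟨J, I, hI, rfl⟩⟩ := hE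
  · exact ⟨h0.le, h0 ▸ hmono zero_le_one⟩
  · rcases J.eq_zero_or_pos with rfl | hJ
    · exact Or.inr ⟨rfl, h0 ▸ IsLastInterval.left_mem hI⟩
    · exact Or.inl ⟨hJ, h0.le, h0 ▸ hmono zero_le_one⟩

/-- `t j` is the time at which the `j`-th interval of the hybrid time domain `E` starts, as long as
there is such an interval; the values of `t` beyond the last jump are irrelevant. -/
structure IsSwitchingSequence (E : Set (ℝ × ℕ)) (t : ℕ → ℝ) : Prop where
  zero : t 0 = 0
  mono : Monotone t
  eq_Icc : ∀ i j, i < j → (hybridSlice E j).Nonempty → hybridSlice E i = Icc (t i) (t (i + 1))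
  isLastInterval : ∀ j, (hybridSlice E j).Nonempty → IsLastInterval (t j) (hybridSlice E j)

theorem isSwitchingSequence_hybridDomainUpTo {t : ℕ → ℝ} {J : ℕ} {I : Set ℝ} (h0 : t 0 = 0)
    (hmono : Monotone t) (hI : IsLastInterval (t J) I) :
    IsSwitchingSequence (hybridDomainUpTo t J I) t := by
  have hle : ∀ j, (hybridSlice (hybridDomainUpTo t J I) j).Nonempty → j ≤ J := fun j hj => by
    by_contra! hJj
    exact hj.ne_empty (hybridSlice_hybridDomainUpTo_of_gt hJj)
  refine ⟨h0, hmono, fun i j hij hj => hybridSlice_hybridDomainUpTo_of_lt (hij.trans_le (hle j hj)),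
    fun j hj => ?_⟩
  rcases (hle j hj).lt_or_eq with hlt | rfl
  · exact Or.inl ⟨_, hmono j.le_succ, hybridSlice_hybridDomainUpTo_of_lt hlt⟩
  · rwa [hybridSlice_hybridDomainUpTo_self]

theorem IsHybridTimeDomain.exists_isSwitchingSequence {E : Set (ℝ × ℕ)}
    (hE : IsHybridTimeDomain E) : ∃ t, IsSwitchingSequence E t := by
  obtain ⟨t, h0, hmono, rfl | ⟨J, I, hI, rfl⟩⟩ := hE
  · exact ⟨t, h0, hmono, fun i j _ _ => rfl, fun j _ => Or.inl ⟨_, hmono j.le_succ, rfl⟩⟩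
  · exact ⟨t, isSwitchingSequence_hybridDomainUpTo h0 hmono hI⟩

namespace IsSwitchingSequence

variable {E : Set (ℝ × ℕ)} {t : ℕ → ℝ} {i j : ℕ} {s : ℝ}

theorem left_mem (ht : IsSwitchingSequence E t) (hj : (hybridSlice E j).Nonempty) :
    t j ∈ hybridSlice E j :=
  (ht.isLastInterval j hj).left_mem

theorem left_le (ht : IsSwitchingSequence E t) (hs : s ∈ hybridSlice E j) : t j ≤ s :=
  (ht.isLastInterval j ⟨s, hs⟩).subset_Ici hs

theorem ordConnected (ht : IsSwitchingSequence E t) (j : ℕ) : (hybridSlice E j).OrdConnected := by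
  rcases (hybridSlice E j).eq_empty_or_nonempty with hempty | hj
  · exact hempty ▸ ordConnected_empty
  · exact (ht.isLastInterval j hj).ordConnected

theorem measurableSet_slice (ht : IsSwitchingSequence E t) (j : ℕ) :
    MeasurableSet (hybridSlice E j) :=
  (ht.ordConnected j).measurableSet

theorem Icc_subset (ht : IsSwitchingSequence E t) (hs : s ∈ hybridSlice E j) :
    Icc (t j) s ⊆ hybridSlice E j :=
  (ht.ordConnected j).out (ht.left_mem ⟨s, hs⟩) hs

theorem right_mem (ht : IsSwitchingSequence E t) (hj : (hybridSlice E (j + 1)).Nonempty) :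
    t (j + 1) ∈ hybridSlice E j := by
  rw [ht.eq_Icc j _ j.lt_succ_self hj]
  exact right_mem_Icc.2 (ht.mono j.le_succ)

theorem eq_of_mem_of_lt (ht : IsSwitchingSequence E t) (hij : i < j) (hi : (s, i) ∈ E)
    (hj : (s, j) ∈ E) : s = t (i + 1) := by
  have hs : s ∈ Icc (t i) (t (i + 1)) := ht.eq_Icc i j hij ⟨s, hj⟩ ▸ hi
  exact le_antisymm hs.2 ((ht.mono hij).trans (ht.left_le hj))

theorem induction (ht : IsSwitchingSequence E t) {P : ℝ → ℕ → Prop} (h0 : P 0 0)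
    (hflow : ∀ (j : ℕ) (a b : ℝ), a ≤ b → Icc a b ⊆ hybridSlice E j → P a j → P b j)
    (hjump : ∀ (s : ℝ) (j : ℕ), (s, j) ∈ E → (s, j + 1) ∈ E → P s j → P s (j + 1))
    (hs : (s, j) ∈ E) : P s j := by
  suffices hstart : ∀ j, (hybridSlice E j).Nonempty → P (t j) j from
    hflow j _ _ (ht.left_le hs) (ht.Icc_subset hs) (hstart j ⟨s, hs⟩)
  intro j
  induction j with
  | zero => exact fun _ => ht.zero.symm ▸ h0
  | succ j ih =>
    intro hj
    have hr := ht.right_mem hj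
    exact hjump _ _ hr (ht.left_mem hj)
      (hflow j _ _ (ht.left_le hr) (ht.Icc_subset hr) (ih ⟨_, hr⟩))

theorem aedisjoint_slice (ht : IsSwitchingSequence E t) :
    Pairwise (Function.onFun (AEDisjoint volume) (hybridSlice E)) := by
  have hlt : ∀ i j, i < j → AEDisjoint volume (hybridSlice E i) (hybridSlice E j) := fun i j hij =>
    measure_mono_null (t := {t (i + 1)}) (fun _ hs => ht.eq_of_mem_of_lt hij hs.1 hs.2)
      Real.volume_singleton
  exact fun i j hij => hij.lt_or_gt.elim (hlt i j) fun hji => (hlt j i hji).symm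

theorem setLIntegral_domTime (ht : IsSwitchingSequence E t) (f : ℝ → ℕ → ℝ≥0∞) :
    ∫⁻ s in domTime E, f s (minJump E s) = ∑' j, ∫⁻ s in hybridSlice E j, f s j := by
  have hunion : domTime E = ⋃ j, hybridSlice E j := by
    ext s
    simp [domTime, hybridSlice]
  rw [hunion, lintegral_iUnion₀ (fun j => (ht.measurableSet_slice j).nullMeasurableSet)
    ht.aedisjoint_slice]
  refine tsum_congr fun j => lintegral_congr_ae ?_
  rw [Filter.EventuallyEq, ae_restrict_iff' (ht.measurableSet_slice j)]
  filter_upwards [(countable_range t).ae_notMem volume] with s hs hj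
  congr 1
  refine le_antisymm (Nat.sInf_le hj) ?_
  by_contra! hlt
  have hmem : (s, minJump E s) ∈ E := Nat.sInf_mem (s := {j | (s, j) ∈ E}) ⟨j, hj⟩
  exact hs ⟨_, (ht.eq_of_mem_of_lt hlt hmem hj).symm⟩

-- A jump adds at most `R` to `v`, and multiplies `exp (c τ)` by at least `exp (c T₁)`: the sum of
-- the jump contributions is a geometric series, which the weight of `exp (c τ)` accounts for.
theorem le_of_dwell_time (ht : IsSwitchingSequence E t) {v τ : ℝ → ℕ → ℝ} {c G R T₁ : ℝ}
    (hc : 0 < c) (hT₁ : 0 < T₁) (hG : 0 ≤ G) (hR : 0 ≤ R)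
    (hτ_flow : ∀ (j : ℕ) (a b : ℝ), a ≤ b → Icc a b ⊆ hybridSlice E j →
      τ b j = τ a j - (b - a))
    (hτ_jump : ∀ (s : ℝ) (j : ℕ), (s, j) ∈ E → (s, j + 1) ∈ E → τ s j = 0 ∧ T₁ ≤ τ s (j + 1))
    (hv_flow : ∀ (j : ℕ) (a b : ℝ), a ≤ b → Icc a b ⊆ hybridSlice E j →
      v b j - G ≤ Real.exp (-c * (b - a)) * (v a j - G))
    (hv_jump : ∀ (s : ℝ) (j : ℕ), (s, j) ∈ E → (s, j + 1) ∈ E → v s (j + 1) ≤ v s j + R)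
    (hs : (s, j) ∈ E) :
    v s j ≤ Real.exp (-c * s) * v 0 0 + G +
      R / (Real.exp (c * T₁) - 1) * Real.exp (c * τ s j) := by
  have hq : 0 < Real.exp (c * T₁) - 1 := sub_pos.2 (Real.one_lt_exp_iff.2 (by positivity))
  set D := R / (Real.exp (c * T₁) - 1) with hD
  have : 0 ≤ D := by positivity
  have hDR : D * Real.exp (c * T₁) = D + R := by
    rw [hD]
    field_simp
    ring
  refine ht.induction (P := fun s j => v s j ≤ Real.exp (-c * s) * v 0 0 + G +
    D * Real.exp (c * τ s j)) ?_ (fun j a b hab hj ha => ?_) (fun s j hs hs' hv => ?_) hs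
  · rw [mul_zero, Real.exp_zero, one_mul, add_assoc]
    exact le_add_of_nonneg_right (by positivity)
  · have hexp_v : Real.exp (-c * b) = Real.exp (-c * (b - a)) * Real.exp (-c * a) := by
      rw [← Real.exp_add]
      ring_nf
    have hexp_τ : Real.exp (c * τ b j) = Real.exp (-c * (b - a)) * Real.exp (c * τ a j) := by
      rw [← Real.exp_add, hτ_flow j a b hab hj]
      ring_nf
    rw [hexp_v, hexp_τ]
    have hscaled := mul_le_mul_of_nonneg_left (sub_le_sub_right ha G)
      (Real.exp_pos (-c * (b - a))).le
    linarith [hv_flow j a b hab hj]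
  · obtain ⟨hτ, hτ'⟩ := hτ_jump s j hs hs'
    rw [hτ, mul_zero, Real.exp_zero, mul_one] at hv
    have hweight : D * Real.exp (c * T₁) ≤ D * Real.exp (c * τ s (j + 1)) := by gcongr
    linarith [hv_jump s j hs hs']

theorem lintegral_domTime_le_of_dissipation (ht : IsSwitchingSequence E t)
    {V y w : ℝ → ℕ → ℝ≥0∞}
    (hflow : ∀ (j : ℕ) (a b : ℝ), a ≤ b → Icc a b ⊆ hybridSlice E j →
      (∫⁻ s in Icc a b, y s j) + V b j ≤ V a j + ∫⁻ s in Icc a b, w s j)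
    (hjump : ∀ (s : ℝ) (j : ℕ), (s, j) ∈ E → (s, j + 1) ∈ E → V s (j + 1) ≤ V s j) :
    ∫⁻ s in domTime E, y s (minJump E s) ≤
      V 0 0 + ∫⁻ s in domTime E, w s (minJump E s) := by
  rw [ht.setLIntegral_domTime y, ht.setLIntegral_domTime w]
  set Y : ℕ → ℝ≥0∞ := fun j => ∫⁻ s in hybridSlice E j, y s j
  set W : ℕ → ℝ≥0∞ := fun j => ∫⁻ s in hybridSlice E j, w s j
  have hstart : ∀ n, (hybridSlice E n).Nonempty →
      ∑ j ∈ Finset.range n, Y j + V (t n) n ≤ V 0 0 + ∑ j ∈ Finset.range n, W j := by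
    intro n
    induction n with
    | zero => simp [ht.zero]
    | succ n ih =>
      intro hn
      have hr := ht.right_mem hn
      have hYW : Y n + V (t (n + 1)) n ≤ V (t n) n + W n := by
        simpa only [Y, W, ht.eq_Icc n _ n.lt_succ_self hn] using
          hflow n _ _ (ht.left_le hr) (ht.Icc_subset hr)
      rw [Finset.sum_range_succ, Finset.sum_range_succ, add_assoc, ← add_assoc (V 0 0)]
      calc _ ≤ ∑ j ∈ Finset.range n, Y j + (V (t n) n + W n) := by
            grw [hjump _ _ hr (ht.left_mem hn), hYW]
        _ ≤ _ := by grw [← add_assoc, ih ⟨_, hr⟩]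
  have hslice : ∀ n, (hybridSlice E n).Nonempty → Y n ≤ V (t n) n + W n := fun n hn =>
    (ht.isLastInterval n hn).setLIntegral_le fun s hs =>
      le_self_add.trans ((hflow n _ _ (ht.left_le hs) (ht.Icc_subset hs)).trans
        (by gcongr; exact lintegral_mono_set (ht.Icc_subset hs)))
  refine ENNReal.tsum_le_of_sum_range_le fun n => ?_
  suffices hsum : ∑ j ∈ Finset.range n, Y j ≤ V 0 0 + ∑ j ∈ Finset.range n, W j by
    grw [hsum, ENNReal.sum_le_tsum]
  induction n with
  | zero => simp
  | succ n ih =>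
    rw [Finset.sum_range_succ, Finset.sum_range_succ]
    rcases (hybridSlice E n).eq_empty_or_nonempty with hempty | hn
    · have hY : Y n = 0 := by simp [Y, hempty]
      rw [hY, add_zero]
      exact ih.trans (by gcongr; exact le_self_add)
    · grw [hslice n hn, ← add_assoc, hstart n hn, add_assoc]

end IsSwitchingSequence

theorem not_isBounded_of_Ici_subset_hybridSlice {E : Set (ℝ × ℕ)} {j : ℕ} {a : ℝ}
    (hE : Ici a ⊆ hybridSlice E j) : ¬ Bornology.IsBounded E := fun hb =>
  not_bddAbove_Ici a <| hb.image_fst.bddAbove.mono <|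
    show Ici a ⊆ Prod.fst '' E from fun s hs => ⟨(s, j), hE hs, rfl⟩

theorem not_isBounded_of_forall_mem {E : Set (ℝ × ℕ)} {t : ℕ → ℝ} (hE : ∀ j, (t j, j) ∈ E) :
    ¬ Bornology.IsBounded E := fun hb =>
  not_bddAbove_univ <| hb.image_snd.bddAbove.mono <|
    show univ ⊆ Prod.snd '' E from fun j _ => ⟨(t j, j), hE j, rfl⟩

end HybridTimeDomain

section LinfNorm

variable {U : Type*} [NormedAddCommGroup U] {E : Set (ℝ × ℕ)} {u : ℝ → ℕ → U}

theorem enorm_le_linfNorm_of_jump {s : ℝ} {j : ℕ} (hs : (s, j) ∈ E) (hs' : (s, j + 1) ∈ E) :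
    ‖u s j‖ₑ ≤ linfNorm E u :=
  le_iSup_of_le (s + j) <| le_max_of_le_right <|
    le_iSup₂_of_le (f := fun (q : ℝ × ℕ) _ => ‖u q.1 q.2‖ₑ) (s, j) ⟨⟨hs, hs'⟩, le_rfl⟩ le_rfl

theorem IsSwitchingSequence.ae_enorm_le_linfNorm {t : ℕ → ℝ} (ht : IsSwitchingSequence E t)
    (u : ℝ → ℕ → U) (j : ℕ) : ∀ᵐ s : ℝ, (s, j) ∈ E → ‖u s j‖ₑ ≤ linfNorm E u := by
  have htrunc : ∀ T : ℕ, ∀ᵐ s : ℝ, ((s, j) ∈ E \ jumpTimes E ∧ s + j ≤ T) →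
      ‖u s j‖ₑ ≤ linfNorm E u := by
    intro T
    have hset : {s : ℝ | (s, j) ∈ E \ jumpTimes E ∧ s + j ≤ T} =
        (hybridSlice E j \ hybridSlice E (j + 1)) ∩ {s : ℝ | s + j ≤ T} := by
      ext s
      simp only [hybridSlice, jumpTimes, mem_sdiff, mem_ofPred_eq, mem_inter_iff]
      tauto
    have hmeas : MeasurableSet {s : ℝ | (s, j) ∈ E \ jumpTimes E ∧ s + j ≤ T} := by
      rw [hset]
      exact ((ht.measurableSet_slice _).diff (ht.measurableSet_slice _)).inter
        (measurableSet_le (by fun_prop) (by fun_prop))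
    refine (ae_restrict_iff' hmeas).1 ?_
    filter_upwards [ae_le_essSup (f := fun s => ‖u s j‖ₑ)] with s hs
    exact hs.trans (le_iSup_of_le T (le_max_of_le_left (le_iSup_of_le j le_rfl)))
  filter_upwards [ae_all_iff.2 htrunc] with s hs hE
  by_cases hj : (s, j + 1) ∈ E
  · exact enorm_le_linfNorm_of_jump hE hj
  · obtain ⟨T, hT⟩ := exists_nat_ge (s + j)
    exact hs T ⟨⟨hE, fun hjump => hj hjump.2⟩, hT⟩

end LinfNorm

section BlockQuadraticForm

variable {m n : Type*} [Fintype m] [Fintype n]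

theorem dotProduct_matHe_mulVec (X : Matrix n n ℝ) (x : n → ℝ) :
    x ⬝ᵥ matHe X *ᵥ x = 2 * (x ⬝ᵥ X *ᵥ x) := by
  rw [matHe, add_mulVec, dotProduct_add, dotProduct_transpose_mulVec, two_mul]

theorem sumElim_dotProduct_fromBlocks_mulVec (X : Matrix m m ℝ) (Y : Matrix m n ℝ)
    (Z : Matrix n n ℝ) (x : m → ℝ) (y : n → ℝ) :
    Sum.elim x y ⬝ᵥ fromBlocks X Y Yᵀ Z *ᵥ Sum.elim x y =
      x ⬝ᵥ X *ᵥ x + 2 * (x ⬝ᵥ Y *ᵥ y) + y ⬝ᵥ Z *ᵥ y := by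
  rw [fromBlocks_mulVec, Sum.elim_comp_inl, Sum.elim_comp_inr, sumElim_dotProduct_sumElim,
    dotProduct_add, dotProduct_add, dotProduct_transpose_mulVec]
  ring

theorem dotProduct_transpose_mulVec_mulVec (K : Matrix m n ℝ) (x : n → ℝ) :
    x ⬝ᵥ Kᵀ *ᵥ (K *ᵥ x) = K *ᵥ x ⬝ᵥ K *ᵥ x :=
  dotProduct_transpose_mulVec _ _ _

theorem dotProduct_mulVec_comm_of_isSymm {P : Matrix n n ℝ} (hP : P.IsSymm) (x y : n → ℝ) :
    x ⬝ᵥ P *ᵥ y = y ⬝ᵥ P *ᵥ x := by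
  conv_lhs => rw [← hP.eq, dotProduct_transpose_mulVec]

theorem dotProduct_transpose_mulVec_mulVec_of_isSymm {P : Matrix m m ℝ} (hP : P.IsSymm)
    (K : Matrix m n ℝ) (x : n → ℝ) (y : m → ℝ) :
    x ⬝ᵥ Kᵀ *ᵥ (P *ᵥ y) = y ⬝ᵥ P *ᵥ (K *ᵥ x) := by
  rw [dotProduct_transpose_mulVec, dotProduct_comm, dotProduct_mulVec_comm_of_isSymm hP]

theorem hasLineDerivAt_dotProduct_mulVec {P : Matrix n n ℝ} (hP : P.IsSymm) (x d : n → ℝ) :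
    HasLineDerivAt ℝ (fun y => y ⬝ᵥ P *ᵥ y) (2 * (x ⬝ᵥ P *ᵥ d)) x d := by
  have hexpand : (fun s : ℝ => (x + s • d) ⬝ᵥ P *ᵥ (x + s • d)) =
      fun s => x ⬝ᵥ P *ᵥ x + s * (2 * (x ⬝ᵥ P *ᵥ d)) + s ^ 2 * (d ⬝ᵥ P *ᵥ d) := by
    ext s
    simp only [mulVec_add, mulVec_smul, dotProduct_add, add_dotProduct, dotProduct_smul,
      smul_dotProduct, smul_eq_mul, dotProduct_mulVec_comm_of_isSymm hP d x]
    ring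
  rw [HasLineDerivAt, hexpand]
  simpa using (((hasDerivAt_id (0 : ℝ)).mul_const (2 * (x ⬝ᵥ P *ᵥ d))).const_add _).fun_add
    (((hasDerivAt_id (0 : ℝ)).pow 2).mul_const (d ⬝ᵥ P *ᵥ d))

end BlockQuadraticForm

section MatrixInequality

variable {nz ny nw nq ns np : ℕ} {p : SampledPlant nz ny nw nq ns np}
  {L : Matrix (Fin nz) (Fin ny) ℝ} {H : Matrix (Fin ny) (Fin ny) ℝ}
  {P₁ : Matrix (Fin nz) (Fin nz) ℝ} {P₂ : Matrix (Fin ny) (Fin ny) ℝ} {δ χ γ lamt T : ℝ}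

namespace SampledPlant

theorem smul_matM_add_smul_matM {a b τ₁ τ₂ τ : ℝ} (hab : a + b = 1)
    (hτ : a * Real.exp (δ * τ₁) + b * Real.exp (δ * τ₂) = Real.exp (δ * τ)) :
    a • p.matM L H P₁ P₂ δ χ γ lamt τ₁ + b • p.matM L H P₁ P₂ δ χ γ lamt τ₂ =
      p.matM L H P₁ P₂ δ χ γ lamt τ := by
  obtain rfl : b = 1 - a := eq_sub_of_add_eq' hab
  ext ((i | i) | (i | i)) ((k | k) | (k | k)) <;>
    simp only [matM, ← hτ, Matrix.add_apply, Matrix.smul_apply, fromBlocks_apply₁₁,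
      fromBlocks_apply₁₂, fromBlocks_apply₂₁, fromBlocks_apply₂₂, transpose_apply, smul_eq_mul,
      Matrix.zero_apply] <;>
    ring

theorem continuous_matM : Continuous fun τ => p.matM L H P₁ P₂ δ χ γ lamt τ := by
  unfold matM
  fun_prop

theorem posDef_neg_matM (hδ : 0 ≤ δ) (h₀ : (-(p.matM L H P₁ P₂ δ χ γ lamt 0)).PosDef)
    (hT : (-(p.matM L H P₁ P₂ δ χ γ lamt T)).PosDef) {τ : ℝ} (hτ : τ ∈ Icc 0 T) :
    (-(p.matM L H P₁ P₂ δ χ γ lamt τ)).PosDef := by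
  have hmem : Real.exp (δ * τ) ∈ segment ℝ (Real.exp (δ * 0)) (Real.exp (δ * T)) := by
    have hδ0 : δ * 0 ≤ δ * τ := mul_le_mul_of_nonneg_left hτ.1 hδ
    have hδT : δ * τ ≤ δ * T := mul_le_mul_of_nonneg_left hτ.2 hδ
    rw [segment_eq_Icc (Real.exp_le_exp.2 (hδ0.trans hδT))]
    exact ⟨Real.exp_le_exp.2 hδ0, Real.exp_le_exp.2 hδT⟩
  obtain ⟨a, b, ha, hb, hab, hexp⟩ := hmem
  rw [← smul_matM_add_smul_matM hab hexp, neg_add, ← smul_neg, ← smul_neg]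
  rcases hb.eq_or_lt with rfl | hb
  · obtain rfl : a = 1 := by simpa using hab
    simpa using h₀
  · exact PosDef.posSemidef_add (h₀.posSemidef.smul ha) (hT.smul hb)

theorem exists_isGreatest_lambdaMax_matM [NeZero nz] (hδ : 0 ≤ δ) (hT0 : 0 ≤ T)
    (h₀ : (-(p.matM L H P₁ P₂ δ χ γ lamt 0)).PosDef)
    (hT : (-(p.matM L H P₁ P₂ δ χ γ lamt T)).PosDef) :
    ∃ β : ℝ, 0 < β ∧
      IsGreatest ((fun τ => lambdaMax (p.matM L H P₁ P₂ δ χ γ lamt τ)) '' Icc 0 T) (-β) ∧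
      ∀ τ ∈ Icc 0 T, ∀ v, v ⬝ᵥ p.matM L H P₁ P₂ δ χ γ lamt τ *ᵥ v ≤ -β * (v ⬝ᵥ v) := by
  have hneg : ∀ τ ∈ Icc 0 T, (-(p.matM L H P₁ P₂ δ χ γ lamt τ)).PosDef := fun τ hτ =>
    posDef_neg_matM hδ h₀ hT hτ
  have hherm : ∀ τ ∈ Icc 0 T, (p.matM L H P₁ P₂ δ χ γ lamt τ).IsHermitian := fun τ hτ => by
    simpa only [neg_neg] using (hneg τ hτ).isHermitian.neg
  obtain ⟨τ₀, hτ₀, hmax⟩ := exists_isGreatest_lambdaMax isCompact_Icc (nonempty_Icc.2 hT0)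
    continuous_matM.continuousOn hherm
  refine ⟨-lambdaMax (p.matM L H P₁ P₂ δ χ γ lamt τ₀),
    neg_pos.2 (lambdaMax_neg_of_posDef_neg (hneg τ₀ hτ₀)), by rwa [neg_neg], fun τ hτ v => ?_⟩
  rw [neg_neg]
  exact (dotProduct_mulVec_le_lambdaMax (hherm τ hτ) v).trans <|
    mul_le_mul_of_nonneg_right (hmax.2 ⟨τ, hτ, rfl⟩) (dotProduct_self_nonneg v)

theorem zeta_dotProduct_self_le
    (hψ : ∀ v₁ v₂ : EuclideanSpace ℝ (Fin nq), ‖p.ψ v₁ - p.ψ v₂‖ ≤ p.ell * ‖v₁ - v₂‖)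
    (v₁ v₂ : Fin nz → ℝ) :
    p.zeta v₁ v₂ ⬝ᵥ p.zeta v₁ v₂ ≤ p.ell ^ 2 * (p.S *ᵥ v₂ ⬝ᵥ p.S *ᵥ v₂) := by
  have hsq := pow_le_pow_left₀ (norm_nonneg _)
    (hψ (WithLp.toLp 2 (p.S *ᵥ v₁)) (WithLp.toLp 2 (p.S *ᵥ (v₁ - v₂)))) 2
  rwa [mul_pow, euclideanNorm_sq_eq_dotProduct, euclideanNorm_sq_eq_dotProduct, WithLp.ofLp_sub,
    WithLp.ofLp_sub, ← mulVec_sub, sub_sub_cancel] at hsq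

theorem dotProduct_matM_mulVec (hP₂ : P₂.IsSymm) (τ : ℝ) (ε : Fin nz → ℝ) (θ : Fin ny → ℝ)
    (w : Fin nw → ℝ) (ζ : Fin ns → ℝ) {dε : Fin nz → ℝ} {dθ : Fin ny → ℝ}
    (hd : p.matF L H *ᵥ Sum.elim ε θ + p.matQ *ᵥ ζ + p.matT *ᵥ w = Sum.elim dε dθ) :
    Sum.elim (Sum.elim ε θ) (Sum.elim w ζ) ⬝ᵥ
        p.matM L H P₁ P₂ δ χ γ 0 τ *ᵥ Sum.elim (Sum.elim ε θ) (Sum.elim w ζ) =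
      2 * (ε ⬝ᵥ P₁ *ᵥ dε) + Real.exp (δ * τ) * (2 * (θ ⬝ᵥ P₂ *ᵥ dθ) - δ * (θ ⬝ᵥ P₂ *ᵥ θ)) +
      p.Cp *ᵥ ε ⬝ᵥ p.Cp *ᵥ ε + χ * p.ell ^ 2 * (p.S *ᵥ ε ⬝ᵥ p.S *ᵥ ε) -
      γ ^ 2 * (w ⬝ᵥ w) - χ * (ζ ⬝ᵥ ζ) := by
  simp only [matF, matQ, matT, fromBlocks_mulVec, fromRows_mulVec, Sum.elim_comp_inl,
    Sum.elim_comp_inr, ← Sum.elim_add_add, Sum.elim_eq_iff] at hd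
  rw [← hd.1, ← hd.2]
  simp only [matM, sumElim_dotProduct_fromBlocks_mulVec]
  simp only [add_mulVec, dotProduct_add, dotProduct_matHe_mulVec, smul_mulVec, dotProduct_smul,
    ← mulVec_mulVec, fromBlocks_mulVec, Sum.elim_comp_inl, Sum.elim_comp_inr,
    sumElim_dotProduct_sumElim,
    dotProduct_transpose_mulVec_mulVec_of_isSymm hP₂, dotProduct_transpose_mulVec_mulVec,
    mulVec_add, smul_eq_mul, zero_mulVec, one_mulVec, mul_zero, zero_sub, sub_mulVec, mulVec_sub,
    dotProduct_sub, add_zero, zero_add, neg_smul, neg_mulVec, dotProduct_neg]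
  ring

end SampledPlant

end MatrixInequality

section Energy

variable {nz ny nw nq ns np : ℕ}

namespace ErrState

theorem sumElim_ε_θ (x : ErrState nz ny) : Sum.elim x.ε x.θ = x.err := by
  ext (i | i) <;> rfl

theorem err_dotProduct_err (x : ErrState nz ny) : x.err ⬝ᵥ x.err = x.ε ⬝ᵥ x.ε + x.θ ⬝ᵥ x.θ := by
  rw [← x.sumElim_ε_θ, sumElim_dotProduct_sumElim]

/-- The Lyapunov function `V(x) = εᵀ P₁ ε + exp(δ τ) θ̃ᵀ P₂ θ̃` of the error system. -/
noncomputable def energy (P₁ : Matrix (Fin nz) (Fin nz) ℝ) (P₂ : Matrix (Fin ny) (Fin ny) ℝ)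
    (δ : ℝ) (x : ErrState nz ny) : ℝ :=
  x.ε ⬝ᵥ P₁ *ᵥ x.ε + Real.exp (δ * x.τ) * (x.θ ⬝ᵥ P₂ *ᵥ x.θ)

variable {P₁ : Matrix (Fin nz) (Fin nz) ℝ} {P₂ : Matrix (Fin ny) (Fin ny) ℝ} {δ : ℝ}

theorem contDiff_energy {k : WithTop ℕ∞} : ContDiff ℝ k (energy P₁ P₂ δ) := by
  unfold energy ε θ err τ dotProduct mulVec dotProduct
  fun_prop

theorem fderiv_energy (hP₁ : P₁.IsSymm) (hP₂ : P₂.IsSymm) (x d : ErrState nz ny) :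
    fderiv ℝ (energy P₁ P₂ δ) x d = 2 * (x.ε ⬝ᵥ P₁ *ᵥ d.ε) +
      Real.exp (δ * x.τ) * (2 * (x.θ ⬝ᵥ P₂ *ᵥ d.θ) + δ * d.τ * (x.θ ⬝ᵥ P₂ *ᵥ x.θ)) := by
  have hexp : HasLineDerivAt ℝ (fun y : ErrState nz ny => Real.exp (δ * y.τ))
      (Real.exp (δ * x.τ) * (δ * d.τ)) x d := by
    have hτ : HasLineDerivAt ℝ τ d.τ x d :=
      (EuclideanSpace.proj (Sum.inr (Sum.inr ())) : ErrState nz ny →L[ℝ] ℝ).hasFDerivAt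
        |>.hasLineDerivAt d
    simpa only [HasLineDerivAt, zero_smul, add_zero] using (HasDerivAt.const_mul δ hτ).exp
  have hline : HasLineDerivAt ℝ (energy P₁ P₂ δ) (2 * (x.ε ⬝ᵥ P₁ *ᵥ d.ε) +
      (Real.exp (δ * x.τ) * (δ * d.τ) * (x.θ ⬝ᵥ P₂ *ᵥ x.θ) +
        Real.exp (δ * x.τ) * (2 * (x.θ ⬝ᵥ P₂ *ᵥ d.θ)))) x d := by
    have hθ := HasDerivAt.mul hexp (hasLineDerivAt_dotProduct_mulVec hP₂ x.θ d.θ)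
    simp only [zero_smul, add_zero] at hθ
    exact HasDerivAt.fun_add (hasLineDerivAt_dotProduct_mulVec hP₁ x.ε d.ε) hθ
  rw [← (contDiff_energy.differentiable one_ne_zero x).lineDeriv_eq_fderiv, hline.lineDeriv]
  ring

theorem energy_le (hδ : 0 ≤ δ) (hP₁ : P₁.IsHermitian) (hP₂ : P₂.PosSemidef) {T ρ : ℝ}
    (hρ₁ : lambdaMax P₁ ≤ ρ) (hρ₂ : lambdaMax P₂ * Real.exp (δ * T) ≤ ρ) {x : ErrState nz ny}
    (hx : x.τ ≤ T) : x.energy P₁ P₂ δ ≤ ρ * (x.err ⬝ᵥ x.err) := by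
  have hθ : 0 ≤ x.θ ⬝ᵥ P₂ *ᵥ x.θ := hP₂.dotProduct_mulVec_nonneg x.θ
  rw [energy, err_dotProduct_err, mul_add]
  gcongr ?_ + ?_
  · exact (dotProduct_mulVec_le_lambdaMax hP₁ _).trans
      (mul_le_mul_of_nonneg_right hρ₁ (dotProduct_self_nonneg _))
  · calc Real.exp (δ * x.τ) * (x.θ ⬝ᵥ P₂ *ᵥ x.θ)
        ≤ Real.exp (δ * T) * (lambdaMax P₂ * (x.θ ⬝ᵥ x.θ)) := by
          gcongr
          exact dotProduct_mulVec_le_lambdaMax hP₂.isHermitian _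
      _ = lambdaMax P₂ * Real.exp (δ * T) * (x.θ ⬝ᵥ x.θ) := by ring
      _ ≤ ρ * (x.θ ⬝ᵥ x.θ) := mul_le_mul_of_nonneg_right hρ₂ (dotProduct_self_nonneg _)

theorem exists_pos_forall_mul_err_le_energy (hδ : 0 ≤ δ) (hP₁ : P₁.PosDef) (hP₂ : P₂.PosDef) :
    ∃ c : ℝ, 0 < c ∧ ∀ x : ErrState nz ny, 0 ≤ x.τ → c * (x.err ⬝ᵥ x.err) ≤ x.energy P₁ P₂ δ := by
  obtain ⟨c₁, hc₁, hle₁⟩ := exists_pos_forall_mul_dotProduct_self_le hP₁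
  obtain ⟨c₂, hc₂, hle₂⟩ := exists_pos_forall_mul_dotProduct_self_le hP₂
  refine ⟨min c₁ c₂, lt_min hc₁ hc₂, fun x hx => ?_⟩
  have hε := dotProduct_self_nonneg x.ε
  have hθ := dotProduct_self_nonneg x.θ
  rw [energy, err_dotProduct_err, mul_add]
  gcongr ?_ + ?_
  · exact (mul_le_mul_of_nonneg_right (min_le_left _ _) hε).trans (hle₁ _)
  · calc min c₁ c₂ * (x.θ ⬝ᵥ x.θ) ≤ c₂ * (x.θ ⬝ᵥ x.θ) := by gcongr; exact min_le_right _ _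
      _ ≤ x.θ ⬝ᵥ P₂ *ᵥ x.θ := hle₂ _
      _ ≤ Real.exp (δ * x.τ) * (x.θ ⬝ᵥ P₂ *ᵥ x.θ) :=
        le_mul_of_one_le_left (hP₂.posSemidef.dotProduct_mulVec_nonneg x.θ)
          (Real.one_le_exp (mul_nonneg hδ hx))

end ErrState

end Energy

section ErrorSystem

variable {nz ny nw nq ns np : ℕ} {p : SampledPlant nz ny nw nq ns np}
  {L : Matrix (Fin nz) (Fin ny) ℝ} {H : Matrix (Fin ny) (Fin ny) ℝ}

theorem ErrInput.norm_sq (v : ErrInput nw ny) : ‖v‖ ^ 2 = v.w ⬝ᵥ v.w + v.η ⬝ᵥ v.η := by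
  rw [euclideanNorm_sq_eq_dotProduct, ← sumElim_dotProduct_sumElim]
  congr 1 <;> ext (i | i) <;> rfl

namespace SampledPlant

theorem infDist_attractor_sq {x : ErrState nz ny} (hx : x.τ ∈ Icc 0 p.T₂) :
    Metric.infDist x p.attractor ^ 2 = x.err ⬝ᵥ x.err := by
  have hdist (y : ErrState nz ny) : dist x y ^ 2 = (x.z - y.z) ⬝ᵥ (x.z - y.z) +
      ((x.err - y.err) ⬝ᵥ (x.err - y.err) + (x.τ - y.τ) * (x.τ - y.τ)) := by
    rw [dist_eq_norm, euclideanNorm_sq_eq_dotProduct]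
    simp [dotProduct, Fintype.sum_sum_type, ErrState.z, ErrState.err, ErrState.τ]
  set y₀ : ErrState nz ny := ErrState.mk x.z 0 x.τ
  have hy₀ : y₀ ∈ p.attractor := ⟨rfl, rfl, hx⟩
  have hdist₀ : dist x y₀ ^ 2 = x.err ⬝ᵥ x.err := by
    rw [hdist, show y₀.z = x.z from rfl, show y₀.err = 0 from rfl, show y₀.τ = x.τ from rfl]
    simp
  have hle : ∀ y ∈ p.attractor, dist x y₀ ≤ dist x y := fun y hy => by
    refine le_of_sq_le_sq ?_ dist_nonneg
    have herr : y.err = 0 := by rw [← y.sumElim_ε_θ, hy.1, hy.2.1, Sum.elim_zero_zero]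
    rw [hdist₀, hdist y, herr, sub_zero]
    linarith [dotProduct_self_nonneg (x.z - y.z), mul_self_nonneg (x.τ - y.τ)]
  rw [← hdist₀, (Metric.infDist_le_dist_of_mem hy₀).antisymm
    ((Metric.le_infDist ⟨y₀, hy₀⟩).2 fun {y} hy => hle y hy)]

theorem components_of_mem_jumpMap {x g : ErrState nz ny} {v : ErrInput nw ny}
    (hg : g ∈ (p.errorSystem L H).jumpMap x v) :
    g.τ ∈ Icc p.T₁ p.T₂ ∧ g.ε = x.ε ∧ g.θ = -v.η := by
  obtain ⟨τ, hτ, rfl⟩ := hg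
  refine ⟨hτ, ?_, ?_⟩ <;> ext i <;>
    simp [ErrState.mk, ErrState.ε, ErrState.θ, ErrState.err, fromBlocks_mulVec, fromRows_mulVec,
      Function.comp_def, neg_mulVec]

end SampledPlant

theorem IsSolutionPair.ae_hasDerivAt {X U Y : Type*} [NormedAddCommGroup X] [NormedSpace ℝ X]
    [NormedAddCommGroup U] {S : HybridSystem X U Y} {E : Set (ℝ × ℕ)} {φ : ℝ → ℕ → X}
    {u : ℝ → ℕ → U} (hs : IsSolutionPair S E φ u) {j : ℕ} {a b : ℝ}
    (hab : Icc a b ⊆ hybridSlice E j) :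
    ∀ᵐ s : ℝ, s ∈ Ioo a b → φ s j ∈ S.flowSet ∧
      HasDerivAt (fun r => φ r j) (S.flowMap (φ s j) (u s j)) s := by
  filter_upwards [hs.flow j] with s hflow hs
  obtain ⟨hmem, hderiv⟩ := hflow (hab (Ioo_subset_Icc_self hs))
  exact ⟨hmem, hderiv.hasDerivAt (Filter.mem_of_superset (Icc_mem_nhds hs.1 hs.2) hab)⟩

namespace IsSolutionPair

variable {E : Set (ℝ × ℕ)} {φ : ℝ → ℕ → ErrState nz ny} {u : ℝ → ℕ → ErrInput nw ny}
  {s : ℝ} {j : ℕ}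

theorem τ_eq (hs : IsSolutionPair (p.errorSystem L H) E φ u) {a b : ℝ} (hab : a ≤ b)
    (hE : Icc a b ⊆ hybridSlice E j) : (φ b j).τ = (φ a j).τ - (b - a) := by
  set timer : ErrState nz ny →L[ℝ] ℝ := EuclideanSpace.proj (Sum.inr (Sum.inr ()))
  have hderiv : ∀ᵐ s : ℝ, s ∈ Ioo a b → HasDerivAt (fun r => (φ r j).τ) (-1) s := by
    filter_upwards [hs.ae_hasDerivAt hE] with s hflow hs
    exact timer.hasFDerivAt.comp_hasDerivAt s (hflow hs).2
  have hac : AbsolutelyContinuousOnInterval (fun s => (φ s j).τ) a b :=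
    absolutelyContinuousOnInterval_comp_contDiff timer.contDiff (hs.arc j a b hab hE)
  linear_combination eq_add_mul_of_ae_hasDerivAt_const hab hac hderiv

theorem τ_mem (hs : IsSolutionPair (p.errorSystem L H) E φ u) (hT₁ : 0 ≤ p.T₁) (hT₂ : 0 ≤ p.T₂)
    (hE : (s, j) ∈ E) : (φ s j).τ ∈ Icc 0 p.T₂ := by
  obtain ⟨t, ht⟩ := hs.domain.exists_isSwitchingSequence
  refine ht.induction (P := fun s j => (φ s j).τ ∈ Icc 0 p.T₂) ?_ ?_ ?_ hE
  · rcases hs.initial with h0 | h0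
    · exact h0
    · exact ⟨h0.ge, (show _ = _ from h0).trans_le hT₂⟩
  · intro j a b hab hE ha
    refine ⟨?_, by linarith [hs.τ_eq hab hE, ha.2]⟩
    by_contra! hneg
    -- The timer would be negative, hence outside the flow set, on a set of positive measure.
    have hlt : a + (φ a j).τ < b := by linarith [hs.τ_eq hab hE]
    have hne : (ae (volume.restrict (Ioo (a + (φ a j).τ) b))).NeBot := by
      rw [ae_restrict_neBot]
      simp [hlt]
    have hflow : ∀ᵐ r ∂volume.restrict (Ioo (a + (φ a j).τ) b),
        r ∈ Ioo (a + (φ a j).τ) b ∧ φ r j ∈ (p.errorSystem L H).flowSet := by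
      rw [ae_restrict_iff' measurableSet_Ioo]
      filter_upwards [hs.ae_hasDerivAt hE] with r hr hmem
      exact ⟨hmem, (hr ⟨by linarith [hmem.1, ha.1], hmem.2⟩).1⟩
    obtain ⟨r, hr, hrτ : _ ∈ Icc _ _⟩ := hflow.exists
    linarith [hrτ.1, hr.1, hs.τ_eq (by linarith [hr.1, ha.1])
      ((Icc_subset_Icc_right hr.2.le).trans hE)]
  · intro s j hE hE' _
    exact Icc_subset_Icc_left hT₁ (SampledPlant.components_of_mem_jumpMap (hs.jump s j hE hE').2).1

theorem mul_T₁_le (hs : IsSolutionPair (p.errorSystem L H) E φ u) (hT₁ : 0 ≤ p.T₁)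
    (hT₂ : 0 ≤ p.T₂) (hE : (s, j) ∈ E) : j * p.T₁ ≤ s + p.T₂ := by
  obtain ⟨t, ht⟩ := hs.domain.exists_isSwitchingSequence
  suffices j * p.T₁ ≤ s + (φ s j).τ by linarith [(hs.τ_mem hT₁ hT₂ hE).2]
  refine ht.induction (P := fun s j => j * p.T₁ ≤ s + (φ s j).τ) ?_ ?_ ?_ hE
  · simpa using (hs.τ_mem hT₁ hT₂ hs.domain.zero_mem).1
  · intro j a b hab hE ha
    linarith [hs.τ_eq hab hE]
  · intro s j hE hE' hle
    obtain ⟨hτ : (φ s j).τ = 0, hjump⟩ := hs.jump s j hE hE'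
    push_cast
    linarith [(SampledPlant.components_of_mem_jumpMap hjump).1.1]

end IsSolutionPair

end ErrorSystem

section StorageFunction

variable {nz ny nw nq ns np : ℕ} {p : SampledPlant nz ny nw nq ns np}
  {L : Matrix (Fin nz) (Fin ny) ℝ} {H : Matrix (Fin ny) (Fin ny) ℝ}

/-- `V` is an exponential storage function of the error system for the supply rate
`γ² |w|² - |y_p|²`: it is comparable to the squared distance to the attractor, dissipates at rate
`β` along flows, and is increased at jumps by the measurement noise `η` only. -/
structure SampledPlant.IsStorageFunction (p : SampledPlant nz ny nw nq ns np)
    (L : Matrix (Fin nz) (Fin ny) ℝ) (H : Matrix (Fin ny) (Fin ny) ℝ) (V : ErrState nz ny → ℝ)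
    (c ρ β γ : ℝ) : Prop where
  contDiff : ContDiff ℝ 1 V
  lower : ∀ x, 0 ≤ x.τ → c * (x.err ⬝ᵥ x.err) ≤ V x
  upper : ∀ x, x.τ ≤ p.T₂ → V x ≤ ρ * (x.err ⬝ᵥ x.err)
  flow : ∀ (x : ErrState nz ny) (v : ErrInput nw ny), x.τ ∈ Icc 0 p.T₂ →
    fderiv ℝ V x ((p.errorSystem L H).flowMap x v) ≤
      -β * (x.err ⬝ᵥ x.err) - p.Cp *ᵥ x.ε ⬝ᵥ p.Cp *ᵥ x.ε + γ ^ 2 * (v.w ⬝ᵥ v.w)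
  jump : ∀ (x : ErrState nz ny) (v : ErrInput nw ny), ∀ g ∈ (p.errorSystem L H).jumpMap x v,
    V g ≤ V x + ρ * (v.η ⬝ᵥ v.η)

namespace ErrState

variable {P₁ : Matrix (Fin nz) (Fin nz) ℝ} {P₂ : Matrix (Fin ny) (Fin ny) ℝ} {δ χ γ β ρ : ℝ}

theorem fderiv_energy_flowMap_le (hχ : 0 ≤ χ)
    (hψ : ∀ v₁ v₂ : EuclideanSpace ℝ (Fin nq), ‖p.ψ v₁ - p.ψ v₂‖ ≤ p.ell * ‖v₁ - v₂‖)
    (hP₁ : P₁.IsSymm) (hP₂ : P₂.IsSymm) (hβ : 0 ≤ β) {x : ErrState nz ny}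
    (hM : ∀ v, v ⬝ᵥ p.matM L H P₁ P₂ δ χ γ 0 x.τ *ᵥ v ≤ -β * (v ⬝ᵥ v)) (v : ErrInput nw ny) :
    fderiv ℝ (energy P₁ P₂ δ) x ((p.errorSystem L H).flowMap x v) ≤
      -β * (x.err ⬝ᵥ x.err) - p.Cp *ᵥ x.ε ⬝ᵥ p.Cp *ᵥ x.ε + γ ^ 2 * (v.w ⬝ᵥ v.w) := by
  set d := (p.errorSystem L H).flowMap x v
  set ζ := p.zeta x.z x.ε
  have herr : p.matF L H *ᵥ Sum.elim x.ε x.θ + p.matQ *ᵥ ζ + p.matT *ᵥ v.w =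
      Sum.elim d.ε d.θ := by
    rw [x.sumElim_ε_θ, d.sumElim_ε_θ]
    rfl
  have hform := hM (Sum.elim (Sum.elim x.ε x.θ) (Sum.elim v.w ζ))
  rw [SampledPlant.dotProduct_matM_mulVec hP₂ _ _ _ _ _ herr] at hform
  simp only [sumElim_dotProduct_sumElim] at hform
  rw [fderiv_energy hP₁ hP₂, show d.τ = -1 from rfl, err_dotProduct_err]
  have hβw := mul_nonneg hβ (dotProduct_self_nonneg v.w)
  have hβζ := mul_nonneg hβ (dotProduct_self_nonneg ζ)
  -- The S-procedure: the Lipschitz bound on `ψ` makes the `χ` terms nonnegative.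
  have hχζ := mul_le_mul_of_nonneg_left (SampledPlant.zeta_dotProduct_self_le hψ x.z x.ε) hχ
  linarith

theorem energy_le_of_mem_jumpMap (hδ : 0 ≤ δ) (hP₂ : P₂.PosSemidef)
    (hρ : lambdaMax P₂ * Real.exp (δ * p.T₂) ≤ ρ) {x g : ErrState nz ny} {v : ErrInput nw ny}
    (hg : g ∈ (p.errorSystem L H).jumpMap x v) :
    g.energy P₁ P₂ δ ≤ x.energy P₁ P₂ δ + ρ * (v.η ⬝ᵥ v.η) := by
  obtain ⟨hτ, hε, hθ⟩ := SampledPlant.components_of_mem_jumpMap hg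
  have hη : 0 ≤ v.η ⬝ᵥ P₂ *ᵥ v.η := hP₂.dotProduct_mulVec_nonneg v.η
  have hxθ : 0 ≤ x.θ ⬝ᵥ P₂ *ᵥ x.θ := hP₂.dotProduct_mulVec_nonneg x.θ
  have hle : Real.exp (δ * g.τ) * (v.η ⬝ᵥ P₂ *ᵥ v.η) ≤ ρ * (v.η ⬝ᵥ v.η) :=
    calc Real.exp (δ * g.τ) * (v.η ⬝ᵥ P₂ *ᵥ v.η)
        ≤ Real.exp (δ * p.T₂) * (lambdaMax P₂ * (v.η ⬝ᵥ v.η)) := by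
          gcongr
          exacts [hτ.2, dotProduct_mulVec_le_lambdaMax hP₂.isHermitian _]
      _ = lambdaMax P₂ * Real.exp (δ * p.T₂) * (v.η ⬝ᵥ v.η) := by ring
      _ ≤ ρ * (v.η ⬝ᵥ v.η) := mul_le_mul_of_nonneg_right hρ (dotProduct_self_nonneg _)
  rw [energy, energy, hε, hθ, mulVec_neg, neg_dotProduct_neg]
  linarith [mul_nonneg (Real.exp_pos (δ * x.τ)).le hxθ]

theorem exists_isStorageFunction_energy (hδ : 0 ≤ δ) (hχ : 0 ≤ χ)
    (hψ : ∀ v₁ v₂ : EuclideanSpace ℝ (Fin nq), ‖p.ψ v₁ - p.ψ v₂‖ ≤ p.ell * ‖v₁ - v₂‖)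
    (hP₁ : P₁.PosDef) (hP₂ : P₂.PosDef) (hβ : 0 ≤ β) (hρ₁ : lambdaMax P₁ ≤ ρ)
    (hρ₂ : lambdaMax P₂ * Real.exp (δ * p.T₂) ≤ ρ)
    (hM : ∀ τ ∈ Icc 0 p.T₂, ∀ v, v ⬝ᵥ p.matM L H P₁ P₂ δ χ γ 0 τ *ᵥ v ≤ -β * (v ⬝ᵥ v)) :
    ∃ c, 0 < c ∧ p.IsStorageFunction L H (energy P₁ P₂ δ) c ρ β γ := by
  obtain ⟨c, hc, hle⟩ := exists_pos_forall_mul_err_le_energy hδ hP₁ hP₂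
  exact ⟨c, hc, contDiff_energy, hle,
    fun x => energy_le hδ hP₁.isHermitian hP₂.posSemidef hρ₁ hρ₂,
    fun x v hx => fderiv_energy_flowMap_le hχ hψ hP₁.isHermitian hP₂.isHermitian hβ (hM _ hx) v,
    fun x v g => energy_le_of_mem_jumpMap hδ hP₂.posSemidef hρ₂⟩

end ErrState

end StorageFunction

section Estimates

variable {nz ny nw nq ns np : ℕ} {p : SampledPlant nz ny nw nq ns np}
  {L : Matrix (Fin nz) (Fin ny) ℝ} {H : Matrix (Fin ny) (Fin ny) ℝ}
  {V : ErrState nz ny → ℝ} {c ρ β γ : ℝ}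
  {E : Set (ℝ × ℕ)} {φ : ℝ → ℕ → ErrState nz ny} {u : ℝ → ℕ → ErrInput nw ny} {s : ℝ} {j : ℕ}

namespace SampledPlant.IsStorageFunction

theorem nonneg (hV : p.IsStorageFunction L H V c ρ β γ) (hc : 0 ≤ c) {x : ErrState nz ny}
    (hx : 0 ≤ x.τ) : 0 ≤ V x :=
  (mul_nonneg hc (dotProduct_self_nonneg x.err)).trans (hV.lower x hx)

theorem absolutelyContinuousOnInterval (hV : p.IsStorageFunction L H V c ρ β γ)
    (hs : IsSolutionPair (p.errorSystem L H) E φ u) {a b : ℝ} (hab : a ≤ b)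
    (hE : Icc a b ⊆ hybridSlice E j) :
    AbsolutelyContinuousOnInterval (fun s => V (φ s j)) a b :=
  absolutelyContinuousOnInterval_comp_contDiff hV.contDiff (hs.arc j a b hab hE)

theorem ae_hasDerivAt_le (hV : p.IsStorageFunction L H V c ρ β γ)
    (hs : IsSolutionPair (p.errorSystem L H) E φ u) {a b : ℝ} (hE : Icc a b ⊆ hybridSlice E j) :
    ∀ᵐ s : ℝ, s ∈ Ioo a b → ∃ V' ≤ -β * ((φ s j).err ⬝ᵥ (φ s j).err) -
      p.Cp *ᵥ (φ s j).ε ⬝ᵥ p.Cp *ᵥ (φ s j).ε + γ ^ 2 * ((u s j).w ⬝ᵥ (u s j).w),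
      HasDerivAt (fun r => V (φ r j)) V' s := by
  filter_upwards [hs.ae_hasDerivAt hE] with s hflow hs
  obtain ⟨hmem, hderiv⟩ := hflow hs
  exact ⟨_, hV.flow _ _ hmem,
    ((hV.contDiff.differentiable one_ne_zero _).hasFDerivAt.comp_hasDerivAt s hderiv)⟩

theorem flow_decay (hV : p.IsStorageFunction L H V c ρ β γ) (hβ : 0 < β) (hρ : 0 < ρ)
    (hT₁ : 0 ≤ p.T₁) (hT₂ : 0 ≤ p.T₂) (hs : IsSolutionPair (p.errorSystem L H) E φ u) {U : ℝ}
    (hu : ∀ᵐ s : ℝ, (s, j) ∈ E → ‖u s j‖ ≤ U) {a b : ℝ} (hab : a ≤ b)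
    (hE : Icc a b ⊆ hybridSlice E j) :
    V (φ b j) - γ ^ 2 * U ^ 2 / (β / ρ) ≤
      Real.exp (-(β / ρ) * (b - a)) * (V (φ a j) - γ ^ 2 * U ^ 2 / (β / ρ)) := by
  refine sub_le_exp_mul_of_ae_hasDerivAt_le hab (hV.absolutelyContinuousOnInterval hs hab hE) ?_
  filter_upwards [hV.ae_hasDerivAt_le hs hE, hu] with s hderiv hus hmem
  obtain ⟨V', hle, hV'⟩ := hderiv hmem
  have hsE : (s, j) ∈ E := hE (Ioo_subset_Icc_self hmem)
  refine ⟨V', hle.trans ?_, hV'⟩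
  have hupper : β / ρ * V (φ s j) ≤ β * ((φ s j).err ⬝ᵥ (φ s j).err) :=
    calc β / ρ * V (φ s j) ≤ β / ρ * (ρ * ((φ s j).err ⬝ᵥ (φ s j).err)) := by
          gcongr
          exact hV.upper _ (hs.τ_mem hT₁ hT₂ hsE).2
      _ = β * ((φ s j).err ⬝ᵥ (φ s j).err) := by field_simp
  have hw : (u s j).w ⬝ᵥ (u s j).w ≤ U ^ 2 :=
    calc (u s j).w ⬝ᵥ (u s j).w ≤ ‖u s j‖ ^ 2 := by
          rw [ErrInput.norm_sq]
          exact le_add_of_nonneg_right (dotProduct_self_nonneg _)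
      _ ≤ U ^ 2 := pow_le_pow_left₀ (norm_nonneg _) (hus hsE) 2
  have hG : β / ρ * (γ ^ 2 * U ^ 2 / (β / ρ)) = γ ^ 2 * U ^ 2 := by field_simp
  linarith [dotProduct_self_nonneg (p.Cp *ᵥ (φ s j).ε),
    mul_le_mul_of_nonneg_left hw (sq_nonneg γ)]

theorem exists_forall_le_exp_mul_add (hV : p.IsStorageFunction L H V c ρ β γ) (hβ : 0 < β)
    (hρ : 0 < ρ) (hT₁ : 0 < p.T₁) (hT₂ : 0 ≤ p.T₂) :
    ∃ K : ℝ, 0 ≤ K ∧ ∀ (E : Set (ℝ × ℕ)) (φ : ℝ → ℕ → ErrState nz ny)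
      (u : ℝ → ℕ → ErrInput nw ny), IsSolutionPair (p.errorSystem L H) E φ u →
      linfNorm E u < ∞ → ∀ (s : ℝ) (j : ℕ), (s, j) ∈ E →
        V (φ s j) ≤ Real.exp (-(β / ρ) * s) * V (φ 0 0) + K * (linfNorm E u).toReal ^ 2 := by
  set r := β / ρ
  have hr : 0 < r := div_pos hβ hρ
  have hexp : 0 < Real.exp (r * p.T₁) - 1 := sub_pos.2 (Real.one_lt_exp_iff.2 (by positivity))
  refine ⟨γ ^ 2 / r + ρ / (Real.exp (r * p.T₁) - 1) * Real.exp (r * p.T₂), by positivity,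
    fun E φ u hs hfin s j hE => ?_⟩
  obtain ⟨t, ht⟩ := hs.domain.exists_isSwitchingSequence
  set U := (linfNorm E u).toReal
  have hnorm {v : ErrInput nw ny} (hv : ‖v‖ₑ ≤ linfNorm E u) : ‖v‖ ≤ U :=
    toReal_enorm v ▸ ENNReal.toReal_mono hfin.ne hv
  have hu (j : ℕ) : ∀ᵐ s : ℝ, (s, j) ∈ E → ‖u s j‖ ≤ U := by
    filter_upwards [ht.ae_enorm_le_linfNorm u j] with s h hs using hnorm (h hs)
  have hjump (s : ℝ) (j : ℕ) (hE : (s, j) ∈ E) (hE' : (s, j + 1) ∈ E) :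
      V (φ s (j + 1)) ≤ V (φ s j) + ρ * U ^ 2 := by
    have hη := pow_le_pow_left₀ (norm_nonneg _) (hnorm (enorm_le_linfNorm_of_jump hE hE')) 2
    rw [ErrInput.norm_sq] at hη
    refine (hV.jump _ _ _ (hs.jump s j hE hE').2).trans ?_
    gcongr
    linarith [dotProduct_self_nonneg (u s j).w]
  calc V (φ s j) ≤ Real.exp (-r * s) * V (φ 0 0) + γ ^ 2 * U ^ 2 / r +
        ρ * U ^ 2 / (Real.exp (r * p.T₁) - 1) * Real.exp (r * (φ s j).τ) :=
      ht.le_of_dwell_time (v := fun s j => V (φ s j)) (τ := fun s j => (φ s j).τ) hr hT₁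
        (by positivity) (by positivity) (fun j a b => hs.τ_eq)
        (fun s j hE hE' => ⟨(hs.jump s j hE hE').1,
          (components_of_mem_jumpMap (hs.jump s j hE hE').2).1.1⟩)
        (fun j a b => hV.flow_decay hβ hρ hT₁.le hT₂ hs (hu j)) hjump hE
    _ ≤ Real.exp (-r * s) * V (φ 0 0) + γ ^ 2 * U ^ 2 / r +
        ρ * U ^ 2 / (Real.exp (r * p.T₁) - 1) * Real.exp (r * p.T₂) := by
      gcongr
      exact (hs.τ_mem hT₁.le hT₂ hE).2
    _ = _ := by ring

end SampledPlant.IsStorageFunction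

theorem le_max_two_mul_of_sq_le {r a b : ℝ} (ha : 0 ≤ a) (hb : 0 ≤ b)
    (h : r ^ 2 ≤ a ^ 2 + b ^ 2) : r ≤ max (2 * a) (2 * b) := by
  have hsum : r ≤ a + b := le_of_sq_le_sq (by nlinarith) (add_nonneg ha hb)
  rcases le_total a b with hab | hab
  · exact le_max_of_le_right (by linarith)
  · exact le_max_of_le_left (by linarith)

theorem isClassK_const_mul {K : ℝ} (hK : 0 < K) : IsClassK fun s => K * s :=
  ⟨by fun_prop, fun _ _ _ _ h => mul_lt_mul_of_pos_left h hK, mul_zero K⟩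

namespace SampledPlant

theorem IsStorageFunction.hasFlowTimeDecayRate (hV : p.IsStorageFunction L H V c ρ β γ)
    (hc : 0 < c) (hβ : 0 < β) (hρ : 0 < ρ) (hT₁ : 0 < p.T₁) (hT₂ : 0 ≤ p.T₂) :
    HasFlowTimeDecayRate (p.errorSystem L H) p.attractor (β / (2 * ρ)) := by
  obtain ⟨K, hK, hdecay⟩ := hV.exists_forall_le_exp_mul_add hβ hρ hT₁ hT₂
  refine ⟨2 * √(ρ / c), fun s => (2 * √(K / c) + 1) * s, by positivity,
    isClassK_const_mul (by positivity), fun E φ u hs hfin s j hE => ?_⟩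
  have hτ := hs.τ_mem hT₁.le hT₂ hE
  have hτ₀ := hs.τ_mem hT₁.le hT₂ hs.domain.zero_mem
  set r₀ := Metric.infDist (φ 0 0) p.attractor
  have hr₀ : 0 ≤ r₀ := Metric.infDist_nonneg
  set U := (linfNorm E u).toReal
  have hU : 0 ≤ U := ENNReal.toReal_nonneg
  have hrate : Real.exp (-(β / ρ) * s) = Real.exp (-(β / (2 * ρ)) * s) ^ 2 := by
    rw [← Real.exp_nat_mul]
    congr 1
    push_cast
    field_simp
  have hsq : Metric.infDist (φ s j) p.attractor ^ 2 ≤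
      (√(ρ / c) * Real.exp (-(β / (2 * ρ)) * s) * r₀) ^ 2 + (√(K / c) * U) ^ 2 := by
    simp only [mul_pow, Real.sq_sqrt (div_pos hρ hc).le, Real.sq_sqrt (div_nonneg hK hc.le),
      ← hrate]
    refine le_of_mul_le_mul_left ?_ hc
    calc c * Metric.infDist (φ s j) p.attractor ^ 2 ≤ V (φ s j) := by
          rw [infDist_attractor_sq hτ]
          exact hV.lower _ hτ.1
      _ ≤ Real.exp (-(β / ρ) * s) * V (φ 0 0) + K * U ^ 2 := hdecay E φ u hs hfin s j hE
      _ ≤ Real.exp (-(β / ρ) * s) * (ρ * r₀ ^ 2) + K * U ^ 2 := by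
          rw [infDist_attractor_sq hτ₀]
          gcongr
          exact hV.upper _ hτ₀.2
      _ = c * (ρ / c * Real.exp (-(β / ρ) * s) * r₀ ^ 2 + K / c * U ^ 2) := by field_simp
  refine (le_max_two_mul_of_sq_le (by positivity) (by positivity) hsq).trans
    (max_le_max (by simp only [mul_assoc, le_refl]) (by linarith))

theorem isPreEISS_of_hasFlowTimeDecayRate (hT₁ : 0 < p.T₁) (hT₂ : 0 ≤ p.T₂) {r : ℝ} (hr : 0 < r)
    (h : HasFlowTimeDecayRate (p.errorSystem L H) p.attractor r) :
    IsPreEISS (p.errorSystem L H) p.attractor := by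
  obtain ⟨κ, ρ, hκ, hρ, hdecay⟩ := h
  set lam := r / (1 + 1 / p.T₁) with hlam
  have hlam0 : 0 < lam := by positivity
  refine ⟨κ * Real.exp (lam * (p.T₂ / p.T₁)), lam, ρ, by positivity, hlam0, hρ,
    fun E φ u hs hfin s j hE => (hdecay E φ u hs hfin s j hE).trans (max_le_max_right _ ?_)⟩
  -- At most `(s + T₂) / T₁` jumps have occurred up to time `s`.
  have hj : lam * j ≤ lam * ((s + p.T₂) / p.T₁) := by
    gcongr
    exact (le_div_iff₀ hT₁).2 (hs.mul_T₁_le hT₁.le hT₂ hE)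
  have hexponent : -r * s ≤ lam * (p.T₂ / p.T₁) + -lam * (s + j) := by
    have hrs : r * s = lam * s + lam * (s / p.T₁) := by rw [hlam]; field_simp
    rw [add_div, mul_add] at hj
    linarith
  rw [mul_assoc κ (Real.exp _) (Real.exp _), ← Real.exp_add]
  gcongr
  exact Metric.infDist_nonneg

end SampledPlant

theorem enorm_toLp_sq {n : Type*} [Fintype n] (v : n → ℝ) :
    ‖(WithLp.toLp 2 v : EuclideanSpace ℝ n)‖ₑ ^ 2 = ENNReal.ofReal (v ⬝ᵥ v) := by
  rw [← ofReal_norm, ← ENNReal.ofReal_pow (norm_nonneg _), euclideanNorm_sq_eq_dotProduct]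

theorem IsSolutionPair.integrableOn_w_dotProduct_w {X Y : Type*} [NormedAddCommGroup X]
    [NormedSpace ℝ X] {S : HybridSystem X (ErrInput nw ny) Y} {φ : ℝ → ℕ → X}
    (hs : IsSolutionPair S E φ u) {a b : ℝ} (hE : Icc a b ⊆ hybridSlice E j) :
    IntegrableOn (fun s => (u s j).w ⬝ᵥ (u s j).w) (Icc a b) := by
  obtain ⟨hmeas, hbdd⟩ := hs.input j
  obtain ⟨K, hK⟩ := hbdd b
  have hcont : Continuous fun v : ErrInput nw ny => v.w ⬝ᵥ v.w := by
    unfold ErrInput.w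
    fun_prop
  refine Integrable.of_bound (hcont.comp_aestronglyMeasurable
    (hmeas.mono_measure (Measure.restrict_mono_set _ hE))) (K ^ 2) ?_
  filter_upwards [ae_restrict_of_ae_restrict_of_subset
    (subset_inter hE Icc_subset_Iic_self) hK] with s hs
  have hsq := pow_le_pow_left₀ (norm_nonneg _) hs 2
  rw [ErrInput.norm_sq] at hsq
  rw [Real.norm_of_nonneg (dotProduct_self_nonneg _)]
  linarith [dotProduct_self_nonneg (u s j).η]

namespace SampledPlant.IsStorageFunction

theorem lintegral_output_add_le (hV : p.IsStorageFunction L H V c ρ β γ) (hc : 0 ≤ c)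
    (hβ : 0 ≤ β) (hT₁ : 0 ≤ p.T₁) (hT₂ : 0 ≤ p.T₂)
    (hs : IsSolutionPair (p.errorSystem L H) E φ u) {a b : ℝ} (hab : a ≤ b)
    (hE : Icc a b ⊆ hybridSlice E j) :
    (∫⁻ s in Icc a b, ‖(p.errorSystem L H).output (φ s j)‖ₑ ^ 2) + ENNReal.ofReal (V (φ b j)) ≤
      ENNReal.ofReal (V (φ a j)) +
        ∫⁻ s in Icc a b, ENNReal.ofReal (γ ^ 2 * ((u s j).w ⬝ᵥ (u s j).w)) := by
  have hout : Continuous fun x : ErrState nz ny => p.Cp *ᵥ x.ε ⬝ᵥ p.Cp *ᵥ x.ε := by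
    unfold ErrState.ε ErrState.err
    fun_prop
  have hφ : ContinuousOn (fun s => φ s j) (Icc a b) :=
    uIcc_of_le hab ▸ (hs.arc j a b hab hE).continuousOn
  have hnonneg (s : ℝ) (hs' : s ∈ Icc a b) : 0 ≤ V (φ s j) :=
    hV.nonneg hc (hs.τ_mem hT₁ hT₂ (hE hs')).1
  refine (add_le_add_left (lintegral_mono fun s => (enorm_toLp_sq _).le) _).trans ?_
  refine lintegral_add_ofReal_le_of_ae_hasDerivAt_le hab
    (hV.absolutelyContinuousOnInterval hs hab hE) (hnonneg a (left_mem_Icc.2 hab))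
    (hnonneg b (right_mem_Icc.2 hab)) (hout.comp_continuousOn hφ).integrableOn_Icc
    ((hs.integrableOn_w_dotProduct_w hE).const_mul _) (fun s => dotProduct_self_nonneg _)
    (fun s => mul_nonneg (sq_nonneg γ) (dotProduct_self_nonneg _)) ?_
  filter_upwards [hV.ae_hasDerivAt_le hs hE] with s hderiv hmem
  obtain ⟨V', hle, hV'⟩ := hderiv hmem
  exact ⟨V', by linarith [mul_nonneg hβ (dotProduct_self_nonneg (φ s j).err)], hV'⟩

theorem lintegral_domTime_output_le (hV : p.IsStorageFunction L H V c ρ β γ) (hc : 0 ≤ c)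
    (hβ : 0 ≤ β) (hγ : 0 ≤ γ) (hT₁ : 0 ≤ p.T₁) (hT₂ : 0 ≤ p.T₂)
    (hs : IsSolutionPair (p.errorSystem L H) E φ u) (hη : ∀ q ∈ E, (u q.1 q.2).η = 0) :
    ∫⁻ s in domTime E, ‖(p.errorSystem L H).output (φ s (minJump E s))‖ₑ ^ 2 ≤
      ENNReal.ofReal (V (φ 0 0)) + ENNReal.ofReal γ ^ 2 * ∫⁻ s in domTime E,
        ‖(WithLp.toLp 2 (u s (minJump E s)).w : EuclideanSpace ℝ (Fin nw))‖ₑ ^ 2 := by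
  obtain ⟨t, ht⟩ := hs.domain.exists_isSwitchingSequence
  have hdiss := ht.lintegral_domTime_le_of_dissipation
    (V := fun s j => ENNReal.ofReal (V (φ s j)))
    (fun j a b => hV.lintegral_output_add_le hc hβ hT₁ hT₂ hs) fun s j hE hE' => by
      have hjump := hV.jump _ _ _ (hs.jump s j hE hE').2
      rw [hη _ hE, zero_dotProduct, mul_zero, add_zero] at hjump
      exact ENNReal.ofReal_le_ofReal hjump
  simpa only [ENNReal.ofReal_mul (sq_nonneg γ), ENNReal.ofReal_pow hγ, ← enorm_toLp_sq,
    lintegral_const_mul' _ _ (ENNReal.pow_ne_top ENNReal.ofReal_ne_top)] using hdiss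

theorem hasL2Gain (hV : p.IsStorageFunction L H V c ρ β γ) (hc : 0 ≤ c) (hβ : 0 ≤ β)
    (hρ : 0 < ρ) (hγ : 0 ≤ γ) (hT₁ : 0 ≤ p.T₁) (hT₂ : 0 ≤ p.T₂) : p.HasL2Gain L H γ := by
  refine ⟨√ρ, Real.sqrt_pos.2 hρ, fun E φ u hs hη => ?_⟩
  have hV₀ : ENNReal.ofReal (V (φ 0 0)) ≤
      ENNReal.ofReal (√ρ * Metric.infDist (φ 0 0) p.attractor) ^ 2 := by
    have hτ₀ := hs.τ_mem hT₁ hT₂ hs.domain.zero_mem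
    rw [← ENNReal.ofReal_pow (mul_nonneg (Real.sqrt_nonneg _) Metric.infDist_nonneg), mul_pow,
      Real.sq_sqrt hρ.le, infDist_attractor_sq hτ₀]
    exact ENNReal.ofReal_le_ofReal (hV.upper _ hτ₀.2)
  have hsqrt (x : ℝ≥0∞) : (x ^ 2) ^ (1 / 2 : ℝ) = x := by
    rw [← ENNReal.rpow_natCast, ← ENNReal.rpow_mul]
    norm_num
  refine (ENNReal.rpow_le_rpow ((hV.lintegral_domTime_output_le hc hβ hγ hT₁ hT₂ hs hη).trans
    (add_le_add_left hV₀ _)) one_half_pos.le).trans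
    ((ENNReal.rpow_add_le_add_rpow _ _ one_half_pos.le (by norm_num)).trans ?_)
  rw [hsqrt, ENNReal.mul_rpow_of_nonneg _ _ one_half_pos.le, hsqrt]

end SampledPlant.IsStorageFunction

end Estimates

section Continuation

/-- The subset of `ℝ × ℕ` that has the time slice `I` at the jump index `k` and otherwise the same
time slices as `E`; it describes the continuation of a hybrid signal by a flow or by a jump. -/
def updateSlice (E : Set (ℝ × ℕ)) (k : ℕ) (I : Set ℝ) : Set (ℝ × ℕ) :=
  {q | q.1 ∈ Function.update (hybridSlice E) k I q.2}

section updateSlice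

variable {E : Set (ℝ × ℕ)} {j k : ℕ} {I : Set ℝ}

theorem hybridSlice_updateSlice_self : hybridSlice (updateSlice E k I) k = I := by
  ext s
  simp [hybridSlice, updateSlice]

theorem hybridSlice_updateSlice_of_ne (hj : j ≠ k) :
    hybridSlice (updateSlice E k I) j = hybridSlice E j := by
  ext s
  simp [hybridSlice, updateSlice, hj]

theorem subset_updateSlice (hI : hybridSlice E k ⊆ I) : E ⊆ updateSlice E k I := by
  rintro ⟨s, j⟩ hE
  obtain rfl | hj := eq_or_ne j k
  · exact hybridSlice_updateSlice_self.ge (hI hE)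
  · exact (hybridSlice_updateSlice_of_ne hj).ge hE

theorem updateSlice_hybridDomainUpTo_self {t : ℕ → ℝ} {J : ℕ} {I' : Set ℝ} :
    updateSlice (hybridDomainUpTo t J I) J I' = hybridDomainUpTo t J I' := by
  ext ⟨s, j⟩
  obtain rfl | hj := eq_or_ne j J <;> simp [updateSlice, hybridSlice, hybridDomainUpTo, *]

theorem isHybridTimeDomain_updateSlice_succ {t : ℕ → ℝ} {J : ℕ} {T : ℝ} (h0 : t 0 = 0)
    (hmono : Monotone t) (hT : t J ≤ T) :
    IsHybridTimeDomain (updateSlice (hybridDomainUpTo t J (Icc (t J) T)) (J + 1) {T}) := by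
  set t' : ℕ → ℝ := fun n => if n ≤ J then t n else T with ht'
  have hmono' : Monotone t' := by
    intro m n hmn
    simp only [ht']
    split_ifs with hm hn
    · exact hmono hmn
    · exact (hmono hm).trans hT
    · omega
    · exact le_rfl
  have hlast : t' (J + 1) = T := if_neg J.not_succ_le_self
  convert isHybridTimeDomain_hybridDomainUpTo (J := J + 1) (I := {T}) (by simpa [ht'] using h0)
    hmono' (Or.inl ⟨T, hlast.le, by rw [hlast, Icc_self]⟩) using 1
  ext ⟨s, j⟩
  suffices hybridSlice (updateSlice (hybridDomainUpTo t J (Icc (t J) T)) (J + 1) {T}) j =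
      hybridSlice (hybridDomainUpTo t' (J + 1) {T}) j from Set.ext_iff.1 this s
  rcases lt_trichotomy j (J + 1) with hj | rfl | hj
  · rw [hybridSlice_updateSlice_of_ne hj.ne, hybridSlice_hybridDomainUpTo_of_lt hj]
    rcases (Nat.lt_succ_iff.1 hj).lt_or_eq with hlt | rfl
    · rw [hybridSlice_hybridDomainUpTo_of_lt hlt]
      simp [ht', hlt.le, Nat.succ_le_of_lt hlt]
    · rw [hybridSlice_hybridDomainUpTo_self, hlast]
      simp [ht']
  · rw [hybridSlice_updateSlice_self, hybridSlice_hybridDomainUpTo_self]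
  · rw [hybridSlice_updateSlice_of_ne hj.ne', hybridSlice_hybridDomainUpTo_of_gt hj,
      hybridSlice_hybridDomainUpTo_of_gt (by omega)]

end updateSlice

variable {X U Y : Type*} [NormedAddCommGroup X] [NormedAddCommGroup U]
  {E : Set (ℝ × ℕ)} {φ : ℝ → ℕ → X} {u : ℝ → ℕ → U} {f : ℝ → X}

theorem IsHybridInput.indicator (hu : IsHybridInput E u)
    (hE : ∀ j, MeasurableSet (hybridSlice E j)) (E' : Set (ℝ × ℕ)) :
    IsHybridInput E' fun s j => (hybridSlice E j).indicator (fun r => u r j) s := by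
  refine fun j => ⟨((aestronglyMeasurable_indicator_iff (hE j)).2 (hu j).1).restrict, fun T => ?_⟩
  obtain ⟨K, hK⟩ := (hu j).2 T
  refine ⟨max K 0, ae_restrict_of_ae_restrict_of_subset inter_subset_right ?_⟩
  rw [ae_restrict_iff' ((hE j).inter measurableSet_Iic)] at hK
  rw [ae_restrict_iff' measurableSet_Iic]
  filter_upwards [hK] with s hs hsT
  by_cases hsE : s ∈ hybridSlice E j
  · rw [indicator_of_mem hsE]
    exact (hs ⟨hsE, hsT⟩).trans (le_max_left _ _)
  · simp [indicator_of_notMem hsE]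

variable [NormedSpace ℝ X] {S : HybridSystem X U Y}

theorem IsSolutionPair.updateSlice (hs : IsSolutionPair S E φ u) {k : ℕ} {I : Set ℝ}
    (hdom : IsHybridTimeDomain (updateSlice E k I)) (hlast : hybridSlice E (k + 1) = ∅)
    (hfφ : EqOn (fun s => φ s k) f (hybridSlice E k))
    (hac : ∀ a b, a ≤ b → Icc a b ⊆ I → AbsolutelyContinuousOnInterval f a b)
    (hflow : ∀ᵐ s : ℝ, s ∈ I → f s ∈ S.flowSet ∧ HasDerivWithinAt f
      (S.flowMap (f s) ((hybridSlice E k).indicator (fun r => u r k) s)) I s)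
    (hjump : ∀ (s : ℝ) (j : ℕ), j + 1 = k → (s, j) ∈ E → s ∈ I →
      φ s j ∈ S.jumpSet ∧ f s ∈ S.jumpMap (φ s j) (u s j)) :
    IsSolutionPair S (updateSlice E k I) (fun s => Function.update (φ s) k (f s))
      fun s j => (hybridSlice E j).indicator (fun r => u r j) s := by
  obtain ⟨t, ht⟩ := hs.domain.exists_isSwitchingSequence
  have hφ (s : ℝ) (j : ℕ) (hE : (s, j) ∈ E) : Function.update (φ s) k (f s) j = φ s j := by
    obtain rfl | hj := eq_or_ne j k
    · rw [Function.update_self, ← hfφ hE]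
    · rw [Function.update_of_ne hj]
  have hu (s : ℝ) (j : ℕ) (hE : (s, j) ∈ E) :
      (hybridSlice E j).indicator (fun r => u r j) s = u s j :=
    indicator_of_mem (show s ∈ hybridSlice E j from hE) _
  have hmem {s : ℝ} {j : ℕ} (hj : j ≠ k) (hE : (s, j) ∈ _root_.updateSlice E k I) : (s, j) ∈ E :=
    (hybridSlice_updateSlice_of_ne hj).le hE
  refine ⟨hdom, fun j a b hab hE => ?_, hs.input.indicator ht.measurableSet_slice _,
    hφ 0 0 hs.domain.zero_mem ▸ hs.initial, fun j => ?_, fun s j hE hE' => ?_⟩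
  · obtain rfl | hj := eq_or_ne j k
    · simpa only [Function.update_self] using
        hac a b hab (hE.trans hybridSlice_updateSlice_self.le)
    · simpa only [Function.update_of_ne hj] using
        hs.arc j a b hab (hE.trans (hybridSlice_updateSlice_of_ne hj).le)
  · obtain rfl | hj := eq_or_ne j k
    · filter_upwards [hflow] with s hs hE
      simpa only [Function.update_self, hybridSlice_updateSlice_self]
        using hs (hybridSlice_updateSlice_self.le hE)
    · filter_upwards [hs.flow j] with s hs hE
      have hsE := hmem hj hE
      simpa only [Function.update_of_ne hj, hybridSlice_updateSlice_of_ne hj, hu s j hsE]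
        using hs hsE
  · have hj : j ≠ k := by
      rintro rfl
      exact notMem_empty s (hlast ▸ hmem j.succ_ne_self hE')
    have hsE := hmem hj hE
    rw [hφ s j hsE, hu s j hsE]
    obtain hk | hk := eq_or_ne (j + 1) k
    · rw [hk, Function.update_self]
      exact hjump s j hk hsE (hybridSlice_updateSlice_self.le (hk ▸ hE'))
    · rw [Function.update_of_ne hk]
      exact hs.jump s j hsE (hmem hk hE')

theorem IsMaximalSolutionPair.subset_hybridSlice (hmax : IsMaximalSolutionPair S E φ u) {k : ℕ}
    {I : Set ℝ} (hI : hybridSlice E k ⊆ I) (hfφ : EqOn (fun s => φ s k) f (hybridSlice E k))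
    (hs : IsSolutionPair S (updateSlice E k I) (fun s => Function.update (φ s) k (f s))
      fun s j => (hybridSlice E j).indicator (fun r => u r j) s) : I ⊆ hybridSlice E k := by
  have heq := hmax.2 _ _ _ hs (subset_updateSlice hI) fun ⟨s, j⟩ hE => ⟨?_,
    indicator_of_mem (show s ∈ hybridSlice E j from hE) _⟩
  · exact (hybridSlice_updateSlice_self.symm.trans (congrArg (hybridSlice · k) heq)).le
  · obtain rfl | hj := eq_or_ne j k
    · exact (Function.update_self _ _ _).trans (hfφ hE).symm
    · exact Function.update_of_ne hj _ _

variable {t : ℕ → ℝ} {J : ℕ} {I : Set ℝ} {T b : ℝ}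

theorem IsMaximalSolutionPair.jumpMap_eq_empty
    (hmax : IsMaximalSolutionPair S (hybridDomainUpTo t J (Icc (t J) T)) φ u) (h0 : t 0 = 0)
    (hmono : Monotone t) (hT : t J ≤ T) (hjump : φ T J ∈ S.jumpSet) :
    S.jumpMap (φ T J) (u T J) = ∅ := by
  refine eq_empty_of_forall_notMem fun g hg => ?_
  set E := hybridDomainUpTo t J (Icc (t J) T)
  have hempty (j : ℕ) (hj : J < j) : hybridSlice E j = ∅ := hybridSlice_hybridDomainUpTo_of_gt hj
  have hfφ : EqOn (fun s => φ s (J + 1)) (fun _ => g) (hybridSlice E (J + 1)) :=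
    hempty _ J.lt_succ_self ▸ eqOn_empty _ _
  have hsol := hmax.1.updateSlice (isHybridTimeDomain_updateSlice_succ h0 hmono hT)
    (hempty _ (by omega)) hfφ (fun a b _ _ => absolutelyContinuousOnInterval_const g a b)
    (by filter_upwards [(countable_singleton T).ae_notMem volume] with s hs hsT using absurd hsT hs)
    (by rintro s j hj - rfl; obtain rfl := Nat.succ_injective hj; exact ⟨hjump, hg⟩)
  have hmem := hmax.subset_hybridSlice (hempty _ J.lt_succ_self ▸ empty_subset _) hfφ hsol rfl
  exact notMem_empty T (hempty _ J.lt_succ_self ▸ hmem)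

theorem IsSolutionPair.ae_hasDerivWithinAt_of_continuation (hs : IsSolutionPair S E φ u) {j : ℕ}
    {a : ℝ} (hE : Ico a T ⊆ hybridSlice E j) (hE' : hybridSlice E j ⊆ Icc a T)
    (hfφ : EqOn (fun s => φ s j) f (hybridSlice E j))
    (hflow : ∀ s ∈ Ioo T b, f s ∈ S.flowSet ∧ HasDerivAt f (S.flowMap (f s) 0) s) :
    ∀ᵐ s : ℝ, s ∈ Icc a b → f s ∈ S.flowSet ∧ HasDerivWithinAt f
      (S.flowMap (f s) ((hybridSlice E j).indicator (fun r => u r j) s)) (Icc a b) s := by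
  filter_upwards [hs.flow j, (countable_singleton a).ae_notMem volume,
    (countable_singleton T).ae_notMem volume, (countable_singleton b).ae_notMem volume]
    with s hold hsa hsT hsb hsab
  rcases lt_or_gt_of_ne hsT with hlt | hgt
  · have hmem : s ∈ Ioo a T := ⟨hsab.1.lt_of_ne' hsa, hlt⟩
    have hsE : s ∈ hybridSlice E j := hE (Ioo_subset_Ico_self hmem)
    have hnhds : hybridSlice E j ∈ nhds s :=
      Filter.mem_of_superset (Ioo_mem_nhds hmem.1 hmem.2) (Ioo_subset_Ico_self.trans hE)
    obtain ⟨hφ, hderiv⟩ := hold hsE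
    rw [indicator_of_mem hsE, ← hfφ hsE]
    exact ⟨hφ, ((hderiv.hasDerivAt hnhds).congr_of_eventuallyEq
      (hfφ.symm.eventuallyEq_of_mem hnhds)).hasDerivWithinAt⟩
  · obtain ⟨hf, hderiv⟩ := hflow s ⟨hgt, hsab.2.lt_of_ne hsb⟩
    rw [indicator_of_notMem fun hsE => hgt.not_ge (hE' hsE).2]
    exact ⟨hf, hderiv.hasDerivWithinAt⟩

theorem IsMaximalSolutionPair.right_mem_of_continuation
    (hmax : IsMaximalSolutionPair S (hybridDomainUpTo t J I) φ u) (h0 : t 0 = 0)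
    (hmono : Monotone t) (hI : t J ∈ I) (hIT : Ico (t J) T ⊆ I) (hIT' : I ⊆ Icc (t J) T)
    (hTb : T ≤ b) (hfφ : EqOn (fun s => φ s J) f I)
    (hac : AbsolutelyContinuousOnInterval f (t J) b)
    (hflow : ∀ s ∈ Ioo T b, f s ∈ S.flowSet ∧ HasDerivAt f (S.flowMap (f s) 0) s) : b ∈ I := by
  have hb : t J ≤ b := (hIT' hI).2.trans hTb
  have hslice : hybridSlice (hybridDomainUpTo t J I) J = I := hybridSlice_hybridDomainUpTo_self
  have hjump (s : ℝ) (j : ℕ) (hj : j + 1 = J) (hE : (s, j) ∈ hybridDomainUpTo t J I)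
      (hs : s ∈ Icc (t J) b) : φ s j ∈ S.jumpSet ∧ f s ∈ S.jumpMap (φ s j) (u s j) := by
    subst hj
    have hsj : s ∈ Icc (t j) (t (j + 1)) :=
      (hybridSlice_hybridDomainUpTo_of_lt j.lt_succ_self).le hE
    obtain rfl : s = t (j + 1) := le_antisymm hsj.2 hs.1
    exact hfφ hI ▸ hmax.1.jump _ j hE (hslice.ge hI)
  refine hslice.le (hmax.subset_hybridSlice (I := Icc (t J) b)
    (hslice.le.trans (hIT'.trans (Icc_subset_Icc_right hTb))) (hslice.symm ▸ hfφ)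
    (hmax.1.updateSlice ?_ (hybridSlice_hybridDomainUpTo_of_gt J.lt_succ_self) (hslice.symm ▸ hfφ)
      (fun x y hxy hsub => hac.mono (by rwa [uIcc_of_le hxy, uIcc_of_le hb]))
      (hmax.1.ae_hasDerivWithinAt_of_continuation (hIT.trans hslice.ge) (hslice.le.trans hIT')
        (hslice.symm ▸ hfφ) hflow) hjump) (right_mem_Icc.2 hb))
  rw [updateSlice_hybridDomainUpTo_self]
  exact isHybridTimeDomain_hybridDomainUpTo h0 hmono (Or.inl ⟨b, hb, rfl⟩)

end Continuation

section LipschitzFlowMap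

theorem lipschitzWith_euclidean_reindex {ι κ : Type*} [Fintype ι] [Fintype κ] (σ : ι → κ) :
    LipschitzWith 1 fun (x : EuclideanSpace ℝ κ) (i : ι) => x (σ i) :=
  LipschitzWith.of_edist_le fun x y => edist_pi_le_iff.2 fun i =>
    (edist_le_pi_edist x.ofLp y.ofLp (σ i)).trans
      (by simpa using PiLp.lipschitzWith_ofLp 2 (fun _ : κ => ℝ) x y)

theorem exists_lipschitzWith_mulVec {m n : Type*} [Fintype m] [Fintype n] (X : Matrix m n ℝ) :
    ∃ K, LipschitzWith K fun v : n → ℝ => X *ᵥ v :=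
  ⟨_, (LinearMap.toContinuousLinearMap X.mulVecLin).lipschitz⟩

variable {nz ny nw nq ns np : ℕ} {p : SampledPlant nz ny nw nq ns np}

theorem ErrState.exists_lipschitzWith_mk (τ : ℝ) :
    ∃ K, LipschitzWith K fun v : (Fin nz → ℝ) × (Fin nz ⊕ Fin ny → ℝ) => mk v.1 v.2 τ := by
  refine ⟨_, (PiLp.lipschitzWith_toLp 2 _).comp (LipschitzWith.of_edist_le fun v v' =>
    edist_pi_le_iff.2 ?_)⟩
  rintro (i | i | i)
  · exact (edist_le_pi_edist v.1 v'.1 i).trans (le_max_left _ _)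
  · exact (edist_le_pi_edist v.2 v'.2 i).trans (le_max_right _ _)
  · simp

namespace SampledPlant

theorem exists_lipschitzWith_psi
    (hψ : ∀ v₁ v₂ : EuclideanSpace ℝ (Fin nq), ‖p.ψ v₁ - p.ψ v₂‖ ≤ p.ell * ‖v₁ - v₂‖) :
    ∃ K, LipschitzWith K p.psi := by
  have hlip : LipschitzWith p.ell.toNNReal p.ψ := LipschitzWith.of_dist_le_mul fun x y => by
    simpa only [dist_eq_norm] using (hψ x y).trans
      (mul_le_mul_of_nonneg_right (Real.le_coe_toNNReal _) (norm_nonneg _))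
  exact ⟨_, (PiLp.lipschitzWith_ofLp 2 _).comp (hlip.comp (PiLp.lipschitzWith_toLp 2 _))⟩

theorem exists_lipschitzWith_flowMap (L : Matrix (Fin nz) (Fin ny) ℝ)
    (H : Matrix (Fin ny) (Fin ny) ℝ)
    (hψ : ∀ v₁ v₂ : EuclideanSpace ℝ (Fin nq), ‖p.ψ v₁ - p.ψ v₂‖ ≤ p.ell * ‖v₁ - v₂‖) :
    ∃ K, LipschitzWith K fun q : ErrState nz ny × ErrInput nw ny =>
      (p.errorSystem L H).flowMap q.1 q.2 := by
  have hz : LipschitzWith 1 (ErrState.z : ErrState nz ny → _) := lipschitzWith_euclidean_reindex _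
  have herr : LipschitzWith 1 (ErrState.err : ErrState nz ny → _) :=
    lipschitzWith_euclidean_reindex _
  have hε : LipschitzWith 1 (ErrState.ε : ErrState nz ny → _) :=
    lipschitzWith_euclidean_reindex fun i => Sum.inr (Sum.inl (Sum.inl i))
  have hw : LipschitzWith 1 (ErrInput.w : ErrInput nw ny → _) := lipschitzWith_euclidean_reindex _
  obtain ⟨_, hA⟩ := exists_lipschitzWith_mulVec p.A
  obtain ⟨_, hB⟩ := exists_lipschitzWith_mulVec p.B
  obtain ⟨_, hN⟩ := exists_lipschitzWith_mulVec p.N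
  obtain ⟨_, hS⟩ := exists_lipschitzWith_mulVec p.S
  obtain ⟨_, hF⟩ := exists_lipschitzWith_mulVec (p.matF L H)
  obtain ⟨_, hQ⟩ := exists_lipschitzWith_mulVec p.matQ
  obtain ⟨_, hT⟩ := exists_lipschitzWith_mulVec p.matT
  obtain ⟨_, hpsi⟩ := exists_lipschitzWith_psi hψ
  obtain ⟨_, hmk⟩ := ErrState.exists_lipschitzWith_mk (nz := nz) (ny := ny) (-1)
  have hz' := ((hA.comp hz).add (hB.comp (hpsi.comp (hS.comp hz)))).comp
    (LipschitzWith.prod_fst (β := ErrInput nw ny))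
  have hzeta := (hpsi.comp (hS.comp hz)).sub (hpsi.comp (hS.comp (hz.sub hε)))
  have herr' := ((hF.comp herr).add (hQ.comp hzeta)).comp
    (LipschitzWith.prod_fst (β := ErrInput nw ny))
  have hflow := hmk.comp ((hz'.add ((hN.comp hw).comp LipschitzWith.prod_snd)).prodMk
    (herr'.add ((hT.comp hw).comp LipschitzWith.prod_snd)))
  exact ⟨_, hflow⟩

end SampledPlant

end LipschitzFlowMap

section Completeness

section FiniteEscape

variable {X U Y : Type*} [NormedAddCommGroup X] [NormedAddCommGroup U]

theorem norm_le_of_lipschitzWith_prod {Z : Type*} [NormedAddCommGroup Z] {F : X × U → Z} {K : ℝ≥0}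
    (hF : LipschitzWith K F) {x : X} {v : U} {R : ℝ} (hv : ‖v‖ ≤ R) :
    ‖F (x, v)‖ ≤ K * ‖x‖ + (K * R + ‖F 0‖) := by
  have hdist : dist (F (x, v)) (F 0) ≤ K * (‖x‖ + R) := by
    refine (hF.dist_le_mul _ _).trans (mul_le_mul_of_nonneg_left ?_ K.2)
    rw [dist_zero_right]
    exact max_le (le_add_of_nonneg_right ((norm_nonneg v).trans hv))
      (hv.trans (le_add_of_nonneg_left (norm_nonneg x)))
  rw [dist_eq_norm] at hdist
  linarith [norm_le_norm_add_norm_sub' (F (x, v)) (F 0)]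

theorem not_isMaximalSolutionPair_hybridDomainUpTo_Ico [InnerProductSpace ℝ X]
    [FiniteDimensional ℝ X] {S : HybridSystem X U Y} {K : ℝ≥0}
    (hF : LipschitzWith K fun q : X × U => S.flowMap q.1 q.2) {t : ℕ → ℝ} (h0 : t 0 = 0)
    (hmono : Monotone t) {J : ℕ} {T : ℝ} (hT : t J < T) (φ : ℝ → ℕ → X) (u : ℝ → ℕ → U) :
    ¬ IsMaximalSolutionPair S (hybridDomainUpTo t J (Ico (t J) T)) φ u := by
  intro hmax
  have hs := hmax.1
  have hslice : hybridSlice (hybridDomainUpTo t J (Ico (t J) T)) J = Ico (t J) T :=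
    hybridSlice_hybridDomainUpTo_self
  obtain ⟨R, hR⟩ := (hs.input J).2 T
  rw [hslice, ae_restrict_iff' (measurableSet_Ico.inter measurableSet_Iic)] at hR
  obtain ⟨M, g, hg, hgφ⟩ := exists_lipschitzWith_eqOn_of_linear_growth (f := fun s => φ s J)
    (a := t J) (T := T)
    (fun b hb => hs.arc J _ _ hb.1 ((Icc_subset_Ico_right hb.2).trans hslice.ge)) (by
      filter_upwards [hs.flow J, hR] with s hflow hu hmem
      have hsI : s ∈ Ico (t J) T := Ioo_subset_Ico_self hmem
      have hnhds : hybridSlice (hybridDomainUpTo t J (Ico (t J) T)) J ∈ nhds s :=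
        Filter.mem_of_superset (Ico_mem_nhds hmem.1 hmem.2) hslice.ge
      exact ⟨_, norm_le_of_lipschitzWith_prod hF (hu ⟨hsI, hmem.2.le⟩),
        (hflow (hslice.ge hsI)).2.hasDerivAt hnhds⟩)
  have hmem : T ∈ Ico (t J) T := hmax.right_mem_of_continuation h0 hmono (left_mem_Ico.2 hT)
    subset_rfl Ico_subset_Icc_self le_rfl hgφ hg.lipschitzOnWith.absolutelyContinuousOnInterval
    fun s hs => absurd (hs.1.trans hs.2) (lt_irrefl T)
  exact lt_irrefl T hmem.2

end FiniteEscape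

variable {nz ny nw nq ns np : ℕ} {p : SampledPlant nz ny nw nq ns np}
  {L : Matrix (Fin nz) (Fin ny) ℝ} {H : Matrix (Fin ny) (Fin ny) ℝ}

namespace SampledPlant

theorem exists_flow_of_τ_pos {K : ℝ≥0} {v : ErrInput nw ny}
    (hF : LipschitzWith K fun x => (p.errorSystem L H).flowMap x v) {x : ErrState nz ny}
    (hx : 0 < x.τ) (hx' : x.τ ≤ p.T₂) (T : ℝ) :
    ∃ b > T, ∃ g : ℝ → ErrState nz ny, g T = x ∧ AbsolutelyContinuousOnInterval g T b ∧
      ∀ s ∈ Ioo T b, g s ∈ (p.errorSystem L H).flowSet ∧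
        HasDerivAt g ((p.errorSystem L H).flowMap (g s) v) s := by
  obtain ⟨h, hh, g, hgT, hac, hderiv⟩ := exists_local_solution_of_lipschitzWith hF x T
  have hb : T < T + min h x.τ := lt_add_of_pos_right T (lt_min hh hx)
  have hbh : T + min h x.τ ≤ T + h := by gcongr; exact min_le_left h x.τ
  refine ⟨_, hb, g, hgT, hac.mono ?_, fun s hs => ⟨?_, hderiv s ⟨hs.1, hs.2.trans_le hbh⟩⟩⟩
  · rw [uIcc_of_le hb.le, uIcc_of_le (hb.le.trans hbh)]
    exact Icc_subset_Icc_right hbh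
  set timer : ErrState nz ny →L[ℝ] ℝ := EuclideanSpace.proj (Sum.inr (Sum.inr ()))
  have hacs : AbsolutelyContinuousOnInterval g T s := hac.mono <| by
    rw [uIcc_of_le hs.1.le, uIcc_of_le (hb.le.trans hbh)]
    exact Icc_subset_Icc_right (hs.2.le.trans hbh)
  have hτ : (g s).τ = x.τ + -1 * (s - T) := hgT ▸ eq_add_mul_of_ae_hasDerivAt_const hs.1.le
    (absolutelyContinuousOnInterval_comp_contDiff timer.contDiff hacs) (.of_forall fun r hr =>
      timer.hasFDerivAt.comp_hasDerivAt r (hderiv r ⟨hr.1, hr.2.trans (hs.2.trans_le hbh)⟩))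
  have hsτ : s < T + x.τ := hs.2.trans_le (by gcongr; exact min_le_right h x.τ)
  exact ⟨by rw [hτ]; linarith, by rw [hτ]; linarith [hs.1]⟩

theorem not_isMaximalSolutionPair_hybridDomainUpTo_Icc (hT₁ : 0 ≤ p.T₁) (hT₁₂ : p.T₁ ≤ p.T₂)
    {K : ℝ≥0} (hF : LipschitzWith K fun x => (p.errorSystem L H).flowMap x (0 : ErrInput nw ny))
    {t : ℕ → ℝ} (h0 : t 0 = 0) (hmono : Monotone t) {J : ℕ} {T : ℝ} (hT : t J ≤ T)
    (φ : ℝ → ℕ → ErrState nz ny) (u : ℝ → ℕ → ErrInput nw ny) :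
    ¬ IsMaximalSolutionPair (p.errorSystem L H) (hybridDomainUpTo t J (Icc (t J) T)) φ u := by
  intro hmax
  have hslice : hybridSlice (hybridDomainUpTo t J (Icc (t J) T)) J = Icc (t J) T :=
    hybridSlice_hybridDomainUpTo_self
  have hτ := hmax.1.τ_mem hT₁ (hT₁.trans hT₁₂) (hslice.ge (right_mem_Icc.2 hT))
  rcases hτ.1.eq_or_lt with hzero | hpos
  · exact notMem_empty _ <| (hmax.jumpMap_eq_empty h0 hmono hT hzero.symm).le
      ⟨p.T₁, left_mem_Icc.2 hT₁₂, rfl⟩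
  obtain ⟨b, hTb, g, hgT, hac, hflow⟩ := exists_flow_of_τ_pos hF hpos hτ.2 T
  have hmem : b ∈ Icc (t J) T := by
    refine hmax.right_mem_of_continuation (f := fun s => if s ≤ T then φ s J else g s) h0 hmono
      (left_mem_Icc.2 hT) Ico_subset_Icc_self subset_rfl hTb.le (fun s hs => (if_pos hs.2).symm)
      (absolutelyContinuousOnInterval_piecewise hT hTb.le (hmax.1.arc J _ _ hT hslice.ge) hac
        hgT.symm) fun s hs => ?_
    have hEq : (fun r => if r ≤ T then φ r J else g r) =ᶠ[nhds s] g := by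
      filter_upwards [Ioi_mem_nhds hs.1] with r hr using if_neg hr.not_ge
    rw [hEq.eq_of_nhds]
    exact ⟨(hflow s hs).1, (hflow s hs).2.congr_of_eventuallyEq hEq⟩
  exact hTb.not_ge hmem.2

theorem not_isBounded_of_isMaximalSolutionPair (hT₁ : 0 ≤ p.T₁) (hT₁₂ : p.T₁ ≤ p.T₂)
    (hψ : ∀ v₁ v₂ : EuclideanSpace ℝ (Fin nq), ‖p.ψ v₁ - p.ψ v₂‖ ≤ p.ell * ‖v₁ - v₂‖)
    {E : Set (ℝ × ℕ)} {φ : ℝ → ℕ → ErrState nz ny} {u : ℝ → ℕ → ErrInput nw ny}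
    (hmax : IsMaximalSolutionPair (p.errorSystem L H) E φ u) : ¬ Bornology.IsBounded E := by
  obtain ⟨K, hK⟩ := exists_lipschitzWith_flowMap (nw := nw) L H hψ
  have hK₀ := hK.comp (LipschitzWith.prodMk_right (0 : ErrInput nw ny))
  obtain ⟨t, h0, hmono, rfl | ⟨J, I, ⟨T, hT, rfl⟩ | ⟨T, hT, rfl⟩ | rfl, rfl⟩⟩ := hmax.1.domain
  · exact not_isBounded_of_forall_mem fun j => left_mem_Icc.2 (hmono j.le_succ)
  · exact absurd hmax (not_isMaximalSolutionPair_hybridDomainUpTo_Icc hT₁ hT₁₂ hK₀ h0 hmono hT φ u)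
  · exact absurd hmax (not_isMaximalSolutionPair_hybridDomainUpTo_Ico hK h0 hmono hT φ u)
  · exact not_isBounded_of_Ici_subset_hybridSlice fun s hs => Or.inr ⟨rfl, hs⟩

end SampledPlant

end Completeness

theorem corollary2 {nz ny nw nq ns np : ℕ} (hnz : 0 < nz) (hny : 0 < ny)
    (p : SampledPlant nz ny nw nq ns np)
    (hell : 0 < p.ell)
    (hψ : ∀ v₁ v₂ : EuclideanSpace ℝ (Fin nq), ‖p.ψ v₁ - p.ψ v₂‖ ≤ p.ell * ‖v₁ - v₂‖)
    (hT₁ : 0 < p.T₁) (hT₁₂ : p.T₁ ≤ p.T₂)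
    (γ : ℝ) (hγ : 0 < γ)
    (P₁ : Matrix (Fin nz) (Fin nz) ℝ) (hP₁ : P₁.PosDef)
    (P₂ : Matrix (Fin ny) (Fin ny) ℝ) (hP₂ : P₂.PosDef)
    (δ χ : ℝ) (hδ : 0 < δ) (hχ : 0 < χ)
    (L : Matrix (Fin nz) (Fin ny) ℝ) (H : Matrix (Fin ny) (Fin ny) ℝ)
    (hM₀ : (-(p.matM L H P₁ P₂ δ χ γ 0 0)).PosDef)
    (hMT : (-(p.matM L H P₁ P₂ δ χ γ 0 p.T₂)).PosDef) :
    ∃ β : ℝ, 0 < β ∧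
      IsGreatest ((fun τ => lambdaMax (p.matM L H P₁ P₂ δ χ γ 0 τ)) '' Set.Icc 0 p.T₂) (-β) ∧
      IsEISS (p.errorSystem L H) p.attractor ∧
      HasFlowTimeDecayRate (p.errorSystem L H) p.attractor
        (β / (2 * max (lambdaMax P₁) (lambdaMax P₂ * Real.exp (δ * p.T₂)))) ∧
      p.HasL2Gain L H γ := by
  have : NeZero nz := ⟨hnz.ne'⟩
  have hT₂ : 0 < p.T₂ := hT₁.trans_le hT₁₂
  obtain ⟨β, hβ, hmax, hM⟩ :=
    SampledPlant.exists_isGreatest_lambdaMax_matM hδ.le hT₂.le hM₀ hMT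
  have hρ : 0 < max (lambdaMax P₁) (lambdaMax P₂ * Real.exp (δ * p.T₂)) :=
    lt_max_of_lt_left (lambdaMax_pos_of_posDef hP₁)
  obtain ⟨c, hc, hV⟩ := ErrState.exists_isStorageFunction_energy hδ.le hχ.le hψ hP₁ hP₂ hβ.le
    (le_max_left _ _) (le_max_right _ _) hM
  have hrate := hV.hasFlowTimeDecayRate hc hβ hρ hT₁ hT₂.le
  exact ⟨β, hβ, hmax,
    ⟨SampledPlant.isPreEISS_of_hasFlowTimeDecayRate hT₁ hT₂.le (by positivity) hrate,
      fun E φ u => SampledPlant.not_isBounded_of_isMaximalSolutionPair hT₁.le hT₁₂ hψ⟩,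
    hrate, hV.hasL2Gain hc.le hβ.le hρ hγ.le hT₁.le hT₂.le⟩
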